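/- **Setting.** A finite vertex set $V$ with an initial coloring $c_0:V\to\{0,1\}$ (arbitrary) by two *basic* colors is given. The edges $e_1,\dots,e_m$ of a bipartite graph $G$ (no self-loops, maximum degree at most $\Delta$) arrive online in a sequence $\sigma$; after each arrival the algorithm must hold a coloring in which no edge that has arrived is monochromatic. Recoloring a vertex with a basic color costs $1$. In addition there are $\Delta+1$ *special* colors; recoloring a vertex with special color $k$ costs $w_k\in[0,D]$, where $D\ge 1$. A *bond* is an inclusion-minimal nonempty edge cut; all bonds of $G$ have at most $\beta$ edges. $\mathrm{OPT}$ is the minimum number of single-vertex recolorings with which one can, knowing $\sigma$ in advance and using only the two basic colors, start from $c_0$ and hold a valid coloring after every arrival. **Algorithm $\mathcal A$** (the two-color algorithm of Azar, Machluf, Patt-Shamir and Touitou). If the arriving edge is not monochromatic, do nothing. Otherwise it joins two connected components; exchange the two colors in the smaller one (ties broken arbitrarily), unless after that more than $2/3$ of the vertices of the merged component would have a color other than their initial one, in which case exchange the colors in the larger one instead. **Moderate sequences.** Fix $\alpha\in(0,1)$. A connected component $C$ is *large* if $|C|>D$, and it is *heavy* if more than $\alpha|C|$ of its vertices were recolored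 by $\mathcal A$ so far. A sequence is *$(D,\alpha)$-moderate* if none of its edges $e_i$ joins two distinct components of the graph of the preceding edges that are both large and heavy with respect to $\mathcal A$ run on the preceding edges. Let $\sigma^{\rm sim}_0$ be empty; $\sigma^{\rm sim}_i=\sigma^{\rm sim}_{i-1}\circ e_i$ if this sequence is $(D,\alpha)$-moderate, and $\sigma^{\rm sim}_i=\sigma^{\rm sim}_{i-1}$ otherwise. **Algorithm $\mathcal B$.** Maintain actual colors $c$, a simulation of $\mathcal A$ with colors $\bar c$ (both initially $c_0$), and a set of vertices marked special (initially empty). When $e_i=(u,v)$ arrives: if $\sigma^{\rm sim}_{i-1}\circ e_i$ is $(D,\alpha)$-moderate, send $e_i$ to $\mathcal A$ and set $c(w):=\bar c(w)$ for every non-special $w$; otherwise, if neither $u$ nor $v$ is special, mark $u$ special. In both cases then do the following: if $u$ and $v$ are both special and $c(u)=c(v)$, recolor $u$ with a free special color; if exactly one of $u,v$ is special and it still has a basic color, recolor it with a free special color. (A special color is free for a vertex if no current neighbor has it; an arbitrary free color is chosen.) Let $R$ be the set of vertices ever recolored by $\mathcal A$ in its run on $\sigma^{\rm sim}_m$, and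 let $\mathrm{cost}_{\mathcal B}(\sigma)$ be the total recoloring cost of $\mathcal B$. **Theorem.** For every fixed $\alpha\in(0,1)$ (for instance $\alpha=1/2$) there are a constant $C>0$ and constants $C'_\beta>0$ ($\beta\in\mathbb N$) such that, for all inputs as above: 1. after every arrival the coloring $c$ held by $\mathcal B$ is valid for the edges that have arrived; 2. $\mathrm{cost}_{\mathcal B}(\sigma)\le C\,|R|\,(\beta^2+\log D)$; 3. $|R|\le 3\,\mathrm{OPT}$; 4. $\mathrm{cost}_{\mathcal B}(\sigma)\le C\,(\beta^2+\log D)\,\mathrm{OPT}$, i.e. $\mathcal B$ is $O(\beta^2+\log D)$-competitive; 5. if $D\ge 2$, then $\mathrm{cost}_{\mathcal B}(\sigma)\le C'_\beta\,\log D\cdot\mathrm{OPT}$, i.e. $\mathcal B$ is $O(\log D)$-competitive when the bond size is bounded. -/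

import Mathlib

/-!  Online recoloring of bipartite graphs with two basic colors and additional special colors.

A sequence of edges is a list of ordered pairs of vertices whose head is the edge that arrived
last: `e :: h` is the sequence `h` followed by the arrival of `e`, and the prefixes (in order of
arrival) of a sequence `σ` are exactly the lists `h` with `h <:+ σ`. -/

namespace Recoloring

variable {V : Type*}

/-- The graph on `V` whose edges are those of the sequence. -/
def seqGraph (σ : List (V × V)) : SimpleGraph V :=
  SimpleGraph.fromRel (fun u v => (u, v) ∈ σ)

/-- A coloring is valid for `G` if no edge of `G` is monochromatic. -/
def IsValid {K : Type*} (G : SimpleGraph V) (c : V → K) : Prop :=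
  ∀ ⦃a b : V⦄, G.Adj a b → c a ≠ c b

/-! ### Bonds -/

/-- The cut of `S`: the edges of `G` with exactly one endpoint in `S`. -/
def edgeCut (G : SimpleGraph V) (S : Set V) : Set (Sym2 V) :=
  {e | e ∈ G.edgeSet ∧ ∃ u ∈ S, ∃ v ∉ S, e = s(u, v)}

/-- A bond is an inclusion-minimal nonempty cut. -/
def IsBond (G : SimpleGraph V) (F : Set (Sym2 V)) : Prop :=
  Minimal (fun F : Set (Sym2 V) => F.Nonempty ∧ ∃ S : Set V, F = edgeCut G S) F

/-- The size of a largest bond (`0` if there is no edge); meant for finite graphs. -/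
noncomputable def largestBond (G : SimpleGraph V) : ℕ :=
  sSup {n : ℕ | ∃ F, IsBond G F ∧ F.ncard = n}

variable [Fintype V]

open Classical in
/-- The vertex set of the connected component of `v` with respect to the edges of `h`. -/
noncomputable def comp (h : List (V × V)) (v : V) : Finset V :=
  {w | (seqGraph h).Reachable v w}

open Classical in
/-- The set of vertices on which two colorings differ. -/
noncomputable def changed {K : Type*} (c c' : V → K) : Finset V :=
  {w | c w ≠ c' w}

/-! ### The offline optimum with two colors of unit cost -/

/-- An offline solution for `σ` with initial coloring `c₀`: a coloring `f h` for every prefix `h`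
of `σ`, starting with `c₀`, such that `f h` is valid for the edges that have arrived so far. -/
def IsOfflineSolution (c₀ : V → Bool) (σ : List (V × V)) (f : List (V × V) → V → Bool) : Prop :=
  f [] = c₀ ∧ ∀ h, h <:+ σ → IsValid (seqGraph h) (f h)

/-- The total number of single-vertex recolorings made along `σ`. -/
noncomputable def recolorings (f : List (V × V) → V → Bool) : List (V × V) → ℕ
  | [] => 0
  | e :: h => recolorings f h + (changed (f h) (f (e :: h))).card

/-- The optimal offline cost when only the two colors of unit cost are used. -/
noncomputable def opt (c₀ : V → Bool) (σ : List (V × V)) : ℕ :=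
  sInf {n : ℕ | ∃ f, IsOfflineSolution c₀ σ f ∧ recolorings f σ = n}

/-! ### Algorithm A (the two-color algorithm of Azar, Machluf, Patt-Shamir and Touitou) -/

open Classical in
/-- Exchange the two colors on the set `S`. -/
noncomputable def flip (S : Finset V) (c : V → Bool) : V → Bool :=
  fun w => if w ∈ S then !(c w) else c w

open Classical in
/-- Merging two components `S` (the smaller one) and `L` whose connecting edge is monochromatic:
recolor `S`, unless this leaves more than two thirds of the vertices of the merged component with
a color that is not their initial one; in that case recolor `L`. -/
noncomputable def mergeA (c₀ : V → Bool) (S L : Finset V) (c : V → Bool) : V → Bool :=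
  if 3 * ((S ∪ L) ∩ changed c₀ (flip S c)).card ≤ 2 * (S ∪ L).card then flip S c else flip L c

open Classical in
/-- The coloring that algorithm A maintains. A nonmonochromatic edge changes nothing; a
monochromatic edge merges two components (in a bipartite graph). The function `tie` decides which
of two components of equal size is treated as the smaller one. -/
noncomputable def colA (c₀ : V → Bool) (tie : List (V × V) → Bool) : List (V × V) → V → Bool
  | [] => c₀
  | e :: h =>
    let c := colA c₀ tie h
    let Cu := comp h e.1
    let Cv := comp h e.2
    if c e.1 ≠ c e.2 then c
    else if Cu.card < Cv.card ∨ (Cu.card = Cv.card ∧ tie (e :: h) = true) then mergeA c₀ Cu Cv c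
    else mergeA c₀ Cv Cu c

open Classical in
/-- The set `R` of vertices ever recolored by algorithm A. -/
noncomputable def recoloredA (c₀ : V → Bool) (tie : List (V × V) → Bool) :
    List (V × V) → Finset V
  | [] => ∅
  | e :: h => recoloredA c₀ tie h ∪ changed (colA c₀ tie h) (colA c₀ tie (e :: h))

/-! ### Moderate sequences -/

/-- A component is small if it has at most `D` vertices (and large otherwise). -/
def IsSmall (D : ℝ) (C : Finset V) : Prop := (C.card : ℝ) ≤ D

open Classical in
/-- A component is light if at most an `α` fraction of it lies in `R` (and heavy otherwise). -/
def IsLight (α : ℝ) (R C : Finset V) : Prop := ((R ∩ C).card : ℝ) / (C.card : ℝ) ≤ α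

/-- `(D, α)`-moderate sequences: no edge connects two distinct components each of which is, when
the edge arrives, both large and heavy. -/
def Moderate (D α : ℝ) (c₀ : V → Bool) (tie : List (V × V) → Bool) : List (V × V) → Prop
  | [] => True
  | e :: h =>
    Moderate D α c₀ tie h ∧
      (¬ (seqGraph h).Reachable e.1 e.2 →
        (IsSmall D (comp h e.1) ∨ IsLight α (recoloredA c₀ tie h) (comp h e.1)) ∨
        (IsSmall D (comp h e.2) ∨ IsLight α (recoloredA c₀ tie h) (comp h e.2)))

open Classical in
/-- The subsequence of the edges that are sent to the simulation of algorithm A. -/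
noncomputable def simSeq (D α : ℝ) (c₀ : V → Bool) (tie : List (V × V) → Bool) :
    List (V × V) → List (V × V)
  | [] => []
  | e :: h =>
    if Moderate D α c₀ tie (e :: simSeq D α c₀ tie h) then e :: simSeq D α c₀ tie h
    else simSeq D α c₀ tie h

/-! ### Algorithm B -/

/-- The colors: two basic ones and `Δ + 1` special ones. -/
abbrev Color (Δ : ℕ) : Type := Bool ⊕ Fin (Δ + 1)

/-- The actual colors, and the set of vertices marked special. -/
structure StateB (V : Type*) (Δ : ℕ) where
  color : V → Color Δ
  special : Finset V

open Classical in
/-- The special colors that are not free for `u`: those of its neighbors. -/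
noncomputable def blocked {Δ : ℕ} (h : List (V × V)) (c : V → Color Δ) (u : V) :
    Finset (Fin (Δ + 1)) :=
  {k | ∃ w, (seqGraph h).Adj u w ∧ c w = Sum.inr k}

/-- A rule for choosing a special color, given the edges so far and the blocked colors, that
always chooses a free special color if there is one. -/
def ChoosesFree {Δ : ℕ}
    (pick : List (V × V) → Finset (Fin (Δ + 1)) → Fin (Δ + 1)) : Prop :=
  ∀ h B, (∃ k, k ∉ B) → pick h B ∉ B

open Classical in
/-- Recolor `u` with a free special color. -/
noncomputable def recolorSpecial {Δ : ℕ}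
    (pick : List (V × V) → Finset (Fin (Δ + 1)) → Fin (Δ + 1))
    (h : List (V × V)) (c : V → Color Δ) (u : V) : V → Color Δ :=
  Function.update c u (Sum.inr (pick h (blocked h c u)))

open Classical in
/-- Procedure `recx` on `(u, v)`; `h` is the sequence of all edges so far, including `(u, v)`. -/
noncomputable def recx {Δ : ℕ}
    (pick : List (V × V) → Finset (Fin (Δ + 1)) → Fin (Δ + 1))
    (h : List (V × V)) (u v : V) (s : StateB V Δ) : StateB V Δ where
  special := s.special
  color :=
    if u ∈ s.special ∧ v ∈ s.special then
      if s.color u = s.color v then recolorSpecial pick h s.color u else s.color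
    else if u ∈ s.special then
      if (s.color u).isLeft then recolorSpecial pick h s.color u else s.color
    else if v ∈ s.special then
      if (s.color v).isLeft then recolorSpecial pick h s.color v else s.color
    else s.color

open Classical in
/-- The state of algorithm B with parameters `D` and `α` after the given sequence of edges. -/
noncomputable def runB (D α : ℝ) {Δ : ℕ} (c₀ : V → Bool) (tie : List (V × V) → Bool)
    (pick : List (V × V) → Finset (Fin (Δ + 1)) → Fin (Δ + 1)) :
    List (V × V) → StateB V Δ
  | [] => ⟨fun w => Sum.inl (c₀ w), ∅⟩
  | e :: h =>
    let s := runB D α c₀ tie pick h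
    let simE := e :: simSeq D α c₀ tie h
    let s' : StateB V Δ :=
      if Moderate D α c₀ tie simE then
        ⟨fun w => if w ∈ s.special then s.color w else Sum.inl (colA c₀ tie simE w), s.special⟩
      else if e.1 ∉ s.special ∧ e.2 ∉ s.special then ⟨s.color, insert e.1 s.special⟩
      else s
    recx pick (e :: h) e.1 e.2 s'

/-- The cost of recoloring a vertex with a given color: `1` for a basic color, `price k` for the
special color `k`. -/
def colorCost {Δ : ℕ} (price : Fin (Δ + 1) → ℝ) : Color Δ → ℝ :=
  Sum.elim (fun _ => 1) price

/-- The total recoloring cost of algorithm B. (In one step no vertex is recolored twice.) -/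
noncomputable def costB (D α : ℝ) {Δ : ℕ} (c₀ : V → Bool) (tie : List (V × V) → Bool)
    (pick : List (V × V) → Finset (Fin (Δ + 1)) → Fin (Δ + 1)) (price : Fin (Δ + 1) → ℝ) :
    List (V × V) → ℝ
  | [] => 0
  | e :: h =>
    costB D α c₀ tie pick price h +
      ∑ w ∈ changed (runB D α c₀ tie pick h).color (runB D α c₀ tie pick (e :: h)).color,
        colorCost price ((runB D α c₀ tie pick (e :: h)).color w)

/-- The set `R`: the vertices ever recolored by the simulated algorithm A. -/
noncomputable def recoloredSim (D α : ℝ) (c₀ : V → Bool) (tie : List (V × V) → Bool)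
    (σ : List (V × V)) : Finset V :=
  recoloredA c₀ tie (simSeq D α c₀ tie σ)

end Recoloring

namespace Recoloring

open scoped Classical

variable {V : Type*}

/-! ### Small cuts -/

/-! The cost of $\mathcal B$ splits into basic recolorings, which only copy those of the simulated
$\mathcal A$, and special recolorings, each of cost at most $D$. Both are compared with $|R|$, and
$|R|$ with OPT.

Basic recolorings (`costA_comp_le`, `costA_le`). An amortized argument gives every component a
potential of order at most $r\,(\log D+1)$, where $r$ counts its recolored vertices. When a
component $X$ is flipped and merged with $Y$, either many vertices of $X$ regain their initial
color, or $|X|\le 4|Y|$. In the second case the potential rises by $|X|$ (`pot_add_add_le_flip`):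
many vertices of $X$ are recolored for the first time, or a light $Y$ dilutes the recolored
fraction, or the size grows by the factor $5/4$ while still $O(D)$. Moderateness guarantees one of
the three.

Special recolorings. A rejected edge joins simulated components with more than $\alpha D$ recolored
vertices each. Since edges between $q$ components number at most $\beta(q-1)$
(`card_add_le_of_between`), there are at most $\beta|R|/(\alpha D)$ rejected edges
(`card_rejected_le`). They bound the number of special vertices, and the same cut lemma, with single
vertices as components, bounds the edges among these by $\beta$ times their number. Every special
recoloring adds a special vertex or an edge between special vertices, so the cost is $D\cdot
O(\beta)\cdot\beta|R|/(\alpha D)=O(\beta^2|R|)$.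

OPT (`card_recoloredSim_le_opt`). On a component an offline coloring equals that of $\mathcal A$ or
is its exact opposite. As $\mathcal A$ leaves at most two thirds of a component displaced, i.e. with
a color other than the initial one, either alternative makes the offline solution touch a third of
what $\mathcal A$ recolors. -/

theorem mk_mem_edgeCut {G : SimpleGraph V} {S : Set V} {a b : V} :
    s(a, b) ∈ edgeCut G S ↔ G.Adj a b ∧ ¬ (a ∈ S ↔ b ∈ S) := by
  constructor
  · rintro ⟨hG, u, hu, v, hv, he⟩
    refine ⟨hG, ?_⟩
    rcases Sym2.eq_iff.1 he with ⟨rfl, rfl⟩ | ⟨rfl, rfl⟩ <;> tauto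
  · rintro ⟨hG, h⟩
    refine ⟨hG, ?_⟩
    by_cases ha : a ∈ S
    · exact ⟨a, ha, b, by tauto, rfl⟩
    · exact ⟨b, by tauto, a, ha, Sym2.eq_swap⟩

theorem ncard_le_largestBond [Finite V] {G : SimpleGraph V} {F : Set (Sym2 V)}
    (hF : IsBond G F) : F.ncard ≤ largestBond G := by
  refine le_csSup ⟨(Set.univ : Set (Sym2 V)).ncard, ?_⟩ ⟨F, hF, rfl⟩
  rintro n ⟨F', -, rfl⟩
  exact Set.ncard_le_ncard (Set.subset_univ _)

/-- Two vertices in different components of a subgraph `H` are separated by a cut that contains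
no edge of `H` and is at most as large as the largest bond. -/
theorem exists_small_cut [Finite V] {G H : SimpleGraph V} {u v : V}
    (hHG : H ≤ G) (huv : ¬ H.Reachable u v) :
    ∃ S : Set V, ¬ (u ∈ S ↔ v ∈ S) ∧ (∀ a b, H.Reachable a b → (a ∈ S ↔ b ∈ S)) ∧
      (edgeCut G S).ncard ≤ largestBond G := by
  let good : Set (Set V) := {S | ¬ (u ∈ S ↔ v ∈ S) ∧ ∀ a b, H.Adj a b → (a ∈ S ↔ b ∈ S)}
  have hgood : good.Nonempty := by
    refine ⟨{w | H.Reachable u w}, ?_, ?_⟩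
    · simpa using huv
    · intro a b hab
      exact ⟨fun h => h.trans hab.reachable, fun h => h.trans hab.symm.reachable⟩
  -- Among the unions of components of `H` separating `u` from `v`, one with the fewest cut edges is
  -- taken; if nonempty, its cut turns out to be a bond.
  obtain ⟨S, hS, hmin⟩ :=
    (Set.toFinite good).exists_minimalFor (fun S => (edgeCut G S).ncard) _ hgood
  have hmin' : ∀ S' ∈ good, (edgeCut G S).ncard ≤ (edgeCut G S').ncard := fun S' h' => by
    rcases le_total (edgeCut G S).ncard (edgeCut G S').ncard with h | h
    · exact h
    · exact hmin h' h
  refine ⟨S, hS.1, ?_, ?_⟩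
  · rintro a b ⟨p⟩
    induction p with
    | nil => rfl
    | cons h _ ih => exact (hS.2 _ _ h).trans ih
  by_cases hne : (edgeCut G S).Nonempty
  swap
  · rw [Set.not_nonempty_iff_eq_empty.1 hne]; simp
  refine ncard_le_largestBond ⟨⟨hne, S, rfl⟩, ?_⟩
  rintro _ ⟨hne', S', rfl⟩ hsub
  have hS' : ∀ a b, H.Adj a b → (a ∈ S' ↔ b ∈ S') := by
    intro a b hab
    by_contra hcon
    exact (mk_mem_edgeCut.1 (hsub (mk_mem_edgeCut.2 ⟨hHG hab, hcon⟩))).2 (hS.2 a b hab)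
  by_contra hns
  by_cases hsep : u ∈ S' ↔ v ∈ S'
  -- If `S'` does not separate `u` and `v`, then `symmDiff S S'` does, and its cut is the cut of `S`
  -- without the nonempty cut of `S'`.
  · have hlt : (edgeCut G (symmDiff S S')).ncard < (edgeCut G S).ncard := by
      refine Set.ncard_lt_ncard ?_ (Set.toFinite _)
      rw [Set.ssubset_iff_exists]
      constructor
      · intro e
        induction e with | _ a b
        intro he
        have := mk_mem_edgeCut.1 he
        by_contra hcon
        have h1 : ¬ (s(a, b) ∈ edgeCut G S') := fun h => hcon (hsub h)
        rw [mk_mem_edgeCut] at hcon h1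
        simp only [Set.mem_symmDiff] at this
        tauto
      · obtain ⟨e, he⟩ := hne'
        refine ⟨e, hsub he, ?_⟩
        have he' := hsub he
        induction e with | _ a b
        rw [mk_mem_edgeCut] at he he' ⊢
        simp only [Set.mem_symmDiff]
        tauto
    refine absurd (hmin' (symmDiff S S') ⟨?_, ?_⟩) (not_le.2 hlt)
    · have := hS.1
      simp only [Set.mem_symmDiff]
      tauto
    · intro a b hab
      have h1 := hS.2 a b hab
      have h2 := hS' a b hab
      simp only [Set.mem_symmDiff]
      tauto
  · exact absurd (hmin' S' ⟨hsep, hS'⟩)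
      (not_le.2 (Set.ncard_lt_ncard ⟨hsub, hns⟩ (Set.toFinite _)))

/-- The number of edges between distinct members of a nonempty set `Q` of components of a
subgraph is at most `β * (#Q - 1)`. -/
theorem card_add_le_of_between [Finite V] {G H : SimpleGraph V} (hHG : H ≤ G)
    {β : ℕ} (hβ : largestBond G ≤ β) (n : ℕ) :
    ∀ (Q : Finset H.ConnectedComponent) (E : Finset (Sym2 V)), Q.card = n → Q.Nonempty →
      (∀ e ∈ E, ∃ a b, e = s(a, b) ∧ G.Adj a b ∧ H.connectedComponentMk a ∈ Q ∧
        H.connectedComponentMk b ∈ Q ∧ H.connectedComponentMk a ≠ H.connectedComponentMk b) →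
      E.card + β ≤ β * Q.card := by
  induction n using Nat.strong_induction_on with
  | _ n ih =>
    intro Q E hn hQ hE
    by_cases hone : Q.card ≤ 1
    · have : E = ∅ := by
        refine Finset.eq_empty_of_forall_notMem fun e he => ?_
        obtain ⟨a, b, -, -, ha, hb, hab⟩ := hE e he
        exact hab (Finset.card_le_one.1 hone _ ha _ hb)
      have hc : Q.card = 1 := le_antisymm hone hQ.card_pos
      simp [this, hc]
    obtain ⟨x, hx, y, hy, hxy⟩ := Finset.one_lt_card.1 (not_le.1 hone)
    obtain ⟨u, rfl⟩ := x.exists_rep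
    obtain ⟨v, rfl⟩ := y.exists_rep
    have huv : ¬ H.Reachable u v := fun h => hxy (SimpleGraph.ConnectedComponent.eq.2 h)
    -- The cut splits no component, so it divides `Q` into two nonempty families of `q₁` and `q₂`
    -- members. Induction gives `β (q₁ - 1) + β (q₂ - 1)` edges inside the families, and at most `β`
    -- edges cross.
    obtain ⟨S, hS, hcl, hcut⟩ := exists_small_cut hHG huv
    let inS : H.ConnectedComponent → Prop := fun x => ∃ a ∈ S, H.connectedComponentMk a = x
    have hin : ∀ a, inS (H.connectedComponentMk a) ↔ a ∈ S := by
      intro a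
      constructor
      · rintro ⟨b, hb, hab⟩
        exact (hcl b a (SimpleGraph.ConnectedComponent.eq.1 hab)).1 hb
      · exact fun ha => ⟨a, ha, rfl⟩
    obtain ⟨outS, hout⟩ : ∃ outS : H.ConnectedComponent → Prop, ∀ x, outS x ↔ ¬ inS x :=
      ⟨_, fun _ => Iff.rfl⟩
    have hsplit : (Q.filter inS).card + (Q.filter outS).card = Q.card := by
      rw [← Finset.card_filter_add_card_filter_not (s := Q) inS]
      simp only [hout]
    have key : ∀ P : H.ConnectedComponent → Prop, (Q.filter P).Nonempty → (Q.filter P).card < n →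
        (E.filter fun e => ∀ a ∈ e, P (H.connectedComponentMk a)).card + β
          ≤ β * (Q.filter P).card := by
      intro P hne hlt
      refine ih _ hlt _ _ rfl hne ?_
      intro e he
      obtain ⟨he, heP⟩ := Finset.mem_filter.1 he
      obtain ⟨a, b, rfl, hab, ha, hb, hne⟩ := hE e he
      exact ⟨a, b, rfl, hab, Finset.mem_filter.2 ⟨ha, heP a (by simp)⟩,
        Finset.mem_filter.2 ⟨hb, heP b (by simp)⟩, hne⟩
    have hex : (Q.filter inS).Nonempty ∧ (Q.filter outS).Nonempty := by
      by_cases hu : u ∈ S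
      · exact ⟨⟨_, Finset.mem_filter.2 ⟨hx, (hin u).2 hu⟩⟩,
          ⟨_, Finset.mem_filter.2 ⟨hy, (hout _).2 fun h => hS (iff_of_true hu ((hin v).1 h))⟩⟩⟩
      · exact ⟨⟨_, Finset.mem_filter.2 ⟨hy, (hin v).2 (by tauto)⟩⟩,
          ⟨_, Finset.mem_filter.2 ⟨hx, (hout _).2 fun h => hu ((hin u).1 h)⟩⟩⟩
    have p1 := hex.1.card_pos
    have p2 := hex.2.card_pos
    have k1 := key inS hex.1 (by omega)
    have k2 := key outS hex.2 (by omega)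
    have k3 : (E.filter fun e => e ∈ edgeCut G S).card ≤ β := by
      refine le_trans ?_ (hcut.trans hβ)
      rw [← Set.ncard_coe_finset]
      exact Set.ncard_le_ncard (fun e he => (Finset.mem_filter.1 he).2) (Set.toFinite _)
    have hcover : E ⊆ (E.filter fun e => ∀ a ∈ e, inS (H.connectedComponentMk a)) ∪
        (E.filter fun e => ∀ a ∈ e, outS (H.connectedComponentMk a)) ∪
        (E.filter fun e => e ∈ edgeCut G S) := by
      intro e he
      obtain ⟨a, b, rfl, hab, -⟩ := hE e he
      simp only [Finset.mem_union, Finset.mem_filter, he, true_and, mk_mem_edgeCut, hab, hout, hin,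
        Sym2.mem_iff, forall_eq_or_imp, forall_eq]
      tauto
    have hle := (Finset.card_le_card hcover).trans
      ((Finset.card_union_le _ _).trans (Nat.add_le_add_right (Finset.card_union_le _ _) _))
    rw [← hsplit, mul_add]
    omega

/-! ### Components -/

theorem seqGraph_mono {h h' : List (V × V)} (hsub : ∀ e ∈ h, e ∈ h') :
    seqGraph h ≤ seqGraph h' := by
  intro a b hab
  simp only [seqGraph, SimpleGraph.fromRel_adj] at hab ⊢
  exact ⟨hab.1, hab.2.imp (hsub _) (hsub _)⟩

theorem seqGraph_nil : seqGraph ([] : List (V × V)) = ⊥ := by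
  ext a b; simp [seqGraph]

theorem seqGraph_cons_adj {e : V × V} {h : List (V × V)} {a b : V} :
    (seqGraph (e :: h)).Adj a b ↔
      (seqGraph h).Adj a b ∨ (a ≠ b ∧ s(a, b) = s(e.1, e.2)) := by
  obtain ⟨x, y⟩ := e
  simp only [seqGraph, SimpleGraph.fromRel_adj, List.mem_cons, Prod.mk.injEq, Sym2.eq_iff]
  tauto

theorem seqGraph_le_cons (e : V × V) (h : List (V × V)) : seqGraph h ≤ seqGraph (e :: h) :=
  seqGraph_mono fun _ => List.mem_cons_of_mem _

theorem mem_of_reachable {G : SimpleGraph V} {S : Set V}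
    (hS : ∀ a b, G.Adj a b → a ∈ S → b ∈ S) {u v : V} (huv : G.Reachable u v) (hu : u ∈ S) :
    v ∈ S := by
  obtain ⟨p⟩ := huv
  induction p with
  | nil => exact hu
  | cons h _ ih => exact ih (hS _ _ h hu)

variable [Fintype V]

theorem mem_comp {h : List (V × V)} {v w : V} : w ∈ comp h v ↔ (seqGraph h).Reachable v w := by
  simp [comp]

theorem self_mem_comp (h : List (V × V)) (v : V) : v ∈ comp h v := mem_comp.2 .rfl

theorem card_comp_pos (h : List (V × V)) (v : V) : 0 < (comp h v).card :=
  Finset.card_pos.2 ⟨v, self_mem_comp h v⟩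

theorem comp_eq_of_mem {h : List (V × V)} {v w : V} (hw : w ∈ comp h v) :
    comp h w = comp h v := by
  ext x
  simp only [mem_comp] at hw ⊢
  exact ⟨hw.trans, hw.symm.trans⟩

theorem disjoint_comp {h : List (V × V)} {v w : V} (hvw : ¬ (seqGraph h).Reachable v w) :
    Disjoint (comp h v) (comp h w) := by
  rw [Finset.disjoint_left]
  intro x hx hx'
  exact hvw ((mem_comp.1 hx).trans (mem_comp.1 hx').symm)

theorem comp_cons_left {e : V × V} {h : List (V × V)} :
    comp (e :: h) e.1 = comp h e.1 ∪ comp h e.2 := by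
  have hmono := seqGraph_le_cons e h
  ext w
  rw [Finset.mem_union]
  constructor
  · intro hw
    refine mem_of_reachable (S := {w | w ∈ comp h e.1 ∨ w ∈ comp h e.2}) ?_ (mem_comp.1 hw)
      (Or.inl (self_mem_comp h _))
    intro a b hab ha
    rcases seqGraph_cons_adj.1 hab with hab | ⟨-, hab⟩
    · simp only [Set.mem_ofPred_eq, mem_comp] at ha ⊢
      exact ha.imp (·.trans hab.reachable) (·.trans hab.reachable)
    · rcases Sym2.eq_iff.1 hab with ⟨rfl, rfl⟩ | ⟨rfl, rfl⟩
      · exact Or.inr (self_mem_comp h _)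
      · exact Or.inl (self_mem_comp h _)
  · simp only [mem_comp]
    rintro (hw | hw)
    · exact hw.mono hmono
    · refine SimpleGraph.Reachable.trans ?_ (hw.mono hmono)
      by_cases hne : e.1 = e.2
      · rw [hne]
      · exact (seqGraph_cons_adj.2 (Or.inr ⟨hne, rfl⟩)).reachable

/-- The components after the arrival of an edge. -/
theorem comp_cons_cases (e : V × V) (h : List (V × V)) (v : V) :
    (comp (e :: h) v = comp h v ∧ ((seqGraph h).Reachable e.1 e.2 ∨
        Disjoint (comp h v) (comp h e.1 ∪ comp h e.2))) ∨
      (comp (e :: h) v = comp h e.1 ∪ comp h e.2 ∧ ¬ (seqGraph h).Reachable e.1 e.2) := by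
  by_cases hv : v ∈ comp h e.1 ∪ comp h e.2
  · have h1 : comp (e :: h) v = comp h e.1 ∪ comp h e.2 := by
      rw [← comp_cons_left] at hv ⊢
      exact comp_eq_of_mem hv
    by_cases hr : (seqGraph h).Reachable e.1 e.2
    · have h2 : comp h e.2 = comp h e.1 := comp_eq_of_mem (mem_comp.2 hr)
      rw [h2, Finset.union_self] at hv h1
      exact Or.inl ⟨by rw [h1, comp_eq_of_mem hv], Or.inl hr⟩
    · exact Or.inr ⟨h1, hr⟩
  · left
    have hd : Disjoint (comp h v) (comp h e.1 ∪ comp h e.2) := by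
      rw [Finset.disjoint_left]
      intro x hx hx'
      apply hv
      simp only [Finset.mem_union, mem_comp] at hx hx' ⊢
      exact hx'.imp (·.trans hx.symm) (·.trans hx.symm)
    refine ⟨?_, Or.inr hd⟩
    ext w
    constructor
    · intro hw
      refine mem_of_reachable (S := {w | w ∈ comp h v}) ?_ (mem_comp.1 hw) (self_mem_comp h v)
      intro a b hab ha
      rcases seqGraph_cons_adj.1 hab with hab | ⟨-, hab⟩
      · exact mem_comp.2 ((mem_comp.1 ha).trans hab.reachable)
      · refine absurd ha (Finset.disjoint_right.1 hd ?_)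
        rcases Sym2.eq_iff.1 hab with ⟨rfl, rfl⟩ | ⟨rfl, rfl⟩
        · exact Finset.mem_union_left _ (self_mem_comp h _)
        · exact Finset.mem_union_right _ (self_mem_comp h _)
    · rw [mem_comp, mem_comp]
      exact (·.mono (seqGraph_le_cons e h))

end Recoloring

namespace Recoloring

open scoped Classical

variable {V : Type*}

/-! ### Algorithm A -/

theorem IsValid.mono {K : Type*} {G H : SimpleGraph V} {c : V → K} (hGH : G ≤ H)
    (hc : IsValid H c) : IsValid G c := fun _ _ hab => hc (hGH hab)

/-- Two valid colorings with two colors agree everywhere or nowhere in a component. -/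
theorem IsValid.eq_iff_eq {G : SimpleGraph V} {c c' : V → Bool} (hc : IsValid G c)
    (hc' : IsValid G c') {u w : V} (huw : G.Reachable u w) : c u = c' u ↔ c w = c' w := by
  obtain ⟨p⟩ := huw
  induction p with
  | nil => rfl
  | cons h _ ih =>
    have key : ∀ a b a' b' : Bool, a ≠ b → a' ≠ b' → (a = a' ↔ b = b') := by decide
    exact (key _ _ _ _ (hc h) (hc' h)).trans ih

/-- Inside one component two valid 2-colorings agree everywhere or nowhere; `c` and `col` agree at
exactly one end of the new edge. This is where bipartiteness, witnessed by `col`, makes a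
monochromatic edge a merge. -/
theorem not_reachable_of_eq {e : V × V} {h : List (V × V)} {c col : V → Bool}
    (hcol : IsValid (seqGraph (e :: h)) col) (he : e.1 ≠ e.2) (hc : IsValid (seqGraph h) c)
    (hce : c e.1 = c e.2) : ¬ (seqGraph h).Reachable e.1 e.2 := by
  intro hr
  have h1 := hc.eq_iff_eq (hcol.mono (seqGraph_le_cons e h)) hr
  have h2 := hcol (seqGraph_cons_adj.2 (Or.inr ⟨he, rfl⟩))
  have key : ∀ a b a' b' : Bool, a = b → a' ≠ b' → ¬ (a = a' ↔ b = b') := by decide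
  exact key _ _ _ _ hce h2 h1

theorem flip_of_mem {X : Finset V} {c : V → Bool} {w : V} (hw : w ∈ X) :
    flip X c w = !(c w) := if_pos hw

theorem flip_of_notMem {X : Finset V} {c : V → Bool} {w : V} (hw : w ∉ X) :
    flip X c w = c w := if_neg hw

theorem card_union_inter {X Y : Finset V} (hXY : Disjoint X Y) (A : Finset V) :
    ((X ∪ Y) ∩ A).card = (X ∩ A).card + (Y ∩ A).card := by
  rw [Finset.union_inter_distrib_right, Finset.card_union_of_disjoint]
  exact hXY.mono Finset.inter_subset_left Finset.inter_subset_left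

variable [Fintype V]

theorem mem_changed {K : Type*} {c c' : V → K} {w : V} : w ∈ changed c c' ↔ c w ≠ c' w := by
  simp [changed]

theorem changed_self {K : Type*} (c : V → K) : changed c c = ∅ := by
  ext; simp [mem_changed]

theorem changed_flip (X : Finset V) (c : V → Bool) : changed c (flip X c) = X := by
  ext w
  by_cases hw : w ∈ X <;> simp [mem_changed, hw, flip_of_mem, flip_of_notMem]

theorem inter_changed_flip_of_disjoint {X Y : Finset V} (hXY : Disjoint X Y) (c₀ c : V → Bool) :
    Y ∩ changed c₀ (flip X c) = Y ∩ changed c₀ c := by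
  ext w
  simp only [Finset.mem_inter, mem_changed]
  exact and_congr_right fun hw => by rw [flip_of_notMem (Finset.disjoint_right.1 hXY hw)]

/-- With two colors, a flip exchanges the displaced vertices of `X` with those having their initial
color. -/
theorem card_inter_changed_flip (X : Finset V) (c₀ c : V → Bool) :
    (X ∩ changed c₀ (flip X c)).card + (X ∩ changed c₀ c).card = X.card := by
  have : X ∩ changed c₀ (flip X c) = X \ changed c₀ c := by
    ext w
    simp only [Finset.mem_inter, Finset.mem_sdiff, mem_changed]
    refine and_congr_right fun hw => ?_
    rw [flip_of_mem hw]
    cases c₀ w <;> cases c w <;> simp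
  rw [this, add_comm]
  exact Finset.card_inter_add_card_sdiff X _

/-- At most two thirds of the vertices of every component have lost their initial color. -/
def Balanced (c₀ : V → Bool) (h : List (V × V)) (c : V → Bool) : Prop :=
  ∀ v, 3 * (comp h v ∩ changed c₀ c).card ≤ 2 * (comp h v).card

theorem colA_cons_of_ne {c₀ : V → Bool} {tie : List (V × V) → Bool} {e : V × V}
    {h : List (V × V)} (hce : colA c₀ tie h e.1 ≠ colA c₀ tie h e.2) :
    colA c₀ tie (e :: h) = colA c₀ tie h := by
  rw [colA, if_pos hce]

/-- The result of merging `S` and `L`: one of them (`X`) is recolored, and it is at most four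
times as large as the other one (`Y`), or its recoloring restores many initial colors. -/
theorem mergeA_cases {c₀ c : V → Bool} {S L : Finset V} (hd : Disjoint S L)
    (hSL : S.card ≤ L.card) :
    ∃ X Y, (X = S ∧ Y = L ∨ X = L ∧ Y = S) ∧ mergeA c₀ S L c = flip X c ∧
      3 * ((X ∪ Y) ∩ changed c₀ (flip X c)).card ≤ 2 * (X ∪ Y).card ∧
      (X.card ≤ 4 * Y.card ∨ 6 * ((X ∪ Y) ∩ changed c₀ (flip X c)).card + X.card
        ≤ 6 * ((X ∪ Y) ∩ changed c₀ c).card) := by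
  by_cases hc : 3 * ((S ∪ L) ∩ changed c₀ (flip S c)).card ≤ 2 * (S ∪ L).card
  · exact ⟨S, L, Or.inl ⟨rfl, rfl⟩, if_pos hc, hc, Or.inl (by omega)⟩
  · refine ⟨L, S, Or.inr ⟨rfl, rfl⟩, if_neg hc, ?_⟩
    rw [card_union_inter hd, inter_changed_flip_of_disjoint hd,
      Finset.card_union_of_disjoint hd] at hc
    rw [card_union_inter hd.symm, card_union_inter hd.symm,
      inter_changed_flip_of_disjoint hd.symm, Finset.card_union_of_disjoint hd.symm]
    -- Let `s`, `l` count the displaced vertices of `S`, `L`. The failed test gives `3l > 2|L| - |S|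
    -- + 3s`. Hence flipping `L` leaves `|L| - l + s < (|S| + |L|)/3` displaced vertices, and if
    -- `|L| > 4|S|` then `12l > 7|L|`, which is the last alternative.
    have h1 := card_inter_changed_flip S c₀ c
    have h2 := card_inter_changed_flip L c₀ c
    omega

/-- The effect of a monochromatic edge on algorithm A. -/
theorem colA_cons_of_eq {c₀ col : V → Bool} {tie : List (V × V) → Bool} {e : V × V}
    {h : List (V × V)} (hcol : IsValid (seqGraph (e :: h)) col) (he : e.1 ≠ e.2)
    (hv : IsValid (seqGraph h) (colA c₀ tie h))
    (hce : colA c₀ tie h e.1 = colA c₀ tie h e.2) :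
    ¬ (seqGraph h).Reachable e.1 e.2 ∧
    ∃ X Y, (X = comp h e.1 ∧ Y = comp h e.2 ∨ X = comp h e.2 ∧ Y = comp h e.1) ∧
      Disjoint X Y ∧ comp h e.1 ∪ comp h e.2 = X ∪ Y ∧
      colA c₀ tie (e :: h) = flip X (colA c₀ tie h) ∧
      3 * ((X ∪ Y) ∩ changed c₀ (colA c₀ tie (e :: h))).card ≤ 2 * (X ∪ Y).card ∧
      (X.card ≤ 4 * Y.card ∨
        6 * ((X ∪ Y) ∩ changed c₀ (colA c₀ tie (e :: h))).card + X.card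
          ≤ 6 * ((X ∪ Y) ∩ changed c₀ (colA c₀ tie h)).card) := by
  have hr := not_reachable_of_eq hcol he hv hce
  refine ⟨hr, ?_⟩
  have hd := disjoint_comp hr
  have hstep := show colA c₀ tie (e :: h) =
    if (comp h e.1).card < (comp h e.2).card ∨
        ((comp h e.1).card = (comp h e.2).card ∧ tie (e :: h) = true)
      then mergeA c₀ (comp h e.1) (comp h e.2) (colA c₀ tie h)
      else mergeA c₀ (comp h e.2) (comp h e.1) (colA c₀ tie h) by
    rw [colA, if_neg (not_not.2 hce)]
  split_ifs at hstep with hcard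
  · obtain ⟨X, Y, hXY, h1, h2⟩ := mergeA_cases (c₀ := c₀) (c := colA c₀ tie h) hd
      (by omega)
    rw [h1] at hstep
    rw [← hstep] at h2
    rcases hXY with ⟨rfl, rfl⟩ | ⟨rfl, rfl⟩
    · exact ⟨_, _, Or.inl ⟨rfl, rfl⟩, hd, rfl, hstep, h2⟩
    · exact ⟨_, _, Or.inr ⟨rfl, rfl⟩, hd.symm, Finset.union_comm _ _, hstep, h2⟩
  · obtain ⟨X, Y, hXY, h1, h2⟩ := mergeA_cases (c₀ := c₀) (c := colA c₀ tie h) hd.symm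
      (by omega)
    rw [h1] at hstep
    rw [← hstep] at h2
    rcases hXY with ⟨rfl, rfl⟩ | ⟨rfl, rfl⟩
    · exact ⟨_, _, Or.inr ⟨rfl, rfl⟩, hd.symm, Finset.union_comm _ _, hstep, h2⟩
    · exact ⟨_, _, Or.inl ⟨rfl, rfl⟩, hd, rfl, hstep, h2⟩

/-- Flipping a whole component preserves validity on old edges and repairs the new one, which has
exactly one end in it. For a merge by flipping, balance comes from `mergeA_cases`; for a merge
without flipping, it is additive over the two parts. -/
theorem colA_spec (c₀ : V → Bool) (tie : List (V × V) → Bool) {col : V → Bool} :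
    ∀ {h : List (V × V)}, (∀ e ∈ h, e.1 ≠ e.2) → IsValid (seqGraph h) col →
      IsValid (seqGraph h) (colA c₀ tie h) ∧ Balanced c₀ h (colA c₀ tie h)
  | [], _, _ => by
    refine ⟨fun a b hab => ?_, fun v => ?_⟩
    · simp [seqGraph_nil] at hab
    · simp [colA, changed_self]
  | e :: h, hl, hcol => by
    have he := hl e (by simp)
    obtain ⟨hv, hb⟩ := colA_spec c₀ tie (fun e' he' => hl e' (List.mem_cons_of_mem _ he'))
      (hcol.mono (seqGraph_le_cons e h))
    by_cases hce : colA c₀ tie h e.1 = colA c₀ tie h e.2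
    · obtain ⟨hr, X, Y, hXY, hd, hC, hA, h23, -⟩ := colA_cons_of_eq hcol he hv hce
      constructor
      · have hadj : ∀ a b, (seqGraph h).Adj a b → (a ∈ X ↔ b ∈ X) := by
          have : ∀ x a b, (seqGraph h).Adj a b → (a ∈ comp h x ↔ b ∈ comp h x) := by
            intro x a b hab
            rw [mem_comp, mem_comp]
            exact ⟨(·.trans hab.reachable), (·.trans hab.symm.reachable)⟩
          rcases hXY with ⟨rfl, -⟩ | ⟨rfl, -⟩ <;> exact this _
        have hsep : (e.1 ∈ X ∧ e.2 ∉ X) ∨ (e.1 ∉ X ∧ e.2 ∈ X) := by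
          rcases hXY with ⟨rfl, rfl⟩ | ⟨rfl, rfl⟩
          · exact Or.inl ⟨self_mem_comp _ _, Finset.disjoint_right.1 hd (self_mem_comp _ _)⟩
          · exact Or.inr ⟨Finset.disjoint_right.1 hd (self_mem_comp _ _), self_mem_comp _ _⟩
        have hends : flip X (colA c₀ tie h) e.1 ≠ flip X (colA c₀ tie h) e.2 := by
          rcases hsep with ⟨h1, h2⟩ | ⟨h1, h2⟩ <;>
            simp [h1, h2, flip_of_mem, flip_of_notMem, hce]
        intro a b hab
        rw [hA]
        rcases seqGraph_cons_adj.1 hab with hab | ⟨-, hab⟩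
        · have h1 := hv hab
          by_cases ha : a ∈ X
          · rw [flip_of_mem ha, flip_of_mem ((hadj a b hab).1 ha)]
            simpa using h1
          · rwa [flip_of_notMem ha, flip_of_notMem (fun h => ha ((hadj a b hab).2 h))]
        · rcases Sym2.eq_iff.1 hab with ⟨rfl, rfl⟩ | ⟨rfl, rfl⟩
          · exact hends
          · exact hends.symm
      · intro v
        rcases comp_cons_cases e h v with ⟨h1, h2 | h2⟩ | ⟨h1, -⟩
        · exact absurd h2 hr
        · rw [h1, hA, inter_changed_flip_of_disjoint]
          · exact hb v
          · rw [hC] at h2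
            exact (h2.mono_right Finset.subset_union_left).symm
        · rw [h1, hC]
          exact h23
    · rw [colA_cons_of_ne hce]
      constructor
      · intro a b hab
        rcases seqGraph_cons_adj.1 hab with hab | ⟨-, hab⟩
        · exact hv hab
        · rcases Sym2.eq_iff.1 hab with ⟨rfl, rfl⟩ | ⟨rfl, rfl⟩
          · exact hce
          · exact Ne.symm hce
      · intro v
        rcases comp_cons_cases e h v with ⟨h1, -⟩ | ⟨h1, h2⟩
        · rw [h1]; exact hb v
        · have hd := disjoint_comp h2
          rw [h1, card_union_inter hd, Finset.card_union_of_disjoint hd]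
          have := hb e.1
          have := hb e.2
          omega

theorem recoloredA_cons (c₀ : V → Bool) (tie : List (V × V) → Bool) (e : V × V)
    (h : List (V × V)) : recoloredA c₀ tie (e :: h) =
      recoloredA c₀ tie h ∪ changed (colA c₀ tie h) (colA c₀ tie (e :: h)) := rfl

/-- The number of recolorings of vertices of `P` by algorithm A. -/
noncomputable def costA (c₀ : V → Bool) (tie : List (V × V) → Bool) (P : Finset V) :
    List (V × V) → ℕ
  | [] => 0
  | e :: h => costA c₀ tie P h + (P ∩ changed (colA c₀ tie h) (colA c₀ tie (e :: h))).card

theorem costA_union (c₀ : V → Bool) (tie : List (V × V) → Bool) {P Q : Finset V}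
    (hPQ : Disjoint P Q) : ∀ h, costA c₀ tie (P ∪ Q) h = costA c₀ tie P h + costA c₀ tie Q h
  | [] => rfl
  | e :: h => by
    rw [costA, costA, costA, costA_union c₀ tie hPQ h, card_union_inter hPQ]
    omega

/-- What a monochromatic edge does to the quantities attached to `X` and `Y`. -/
theorem flip_step {c₀ : V → Bool} {tie : List (V × V) → Bool} {e : V × V} {h : List (V × V)}
    {X : Finset V} (hA : colA c₀ tie (e :: h) = flip X (colA c₀ tie h)) :
    recoloredA c₀ tie (e :: h) = recoloredA c₀ tie h ∪ X ∧
      ∀ P, costA c₀ tie P (e :: h) = costA c₀ tie P h + (P ∩ X).card := by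
  constructor
  · rw [recoloredA_cons, hA, changed_flip]
  · intro P
    rw [costA, hA, changed_flip]

theorem stay_step {c₀ : V → Bool} {tie : List (V × V) → Bool} {e : V × V} {h : List (V × V)}
    (hA : colA c₀ tie (e :: h) = colA c₀ tie h) :
    recoloredA c₀ tie (e :: h) = recoloredA c₀ tie h ∧
      ∀ P, costA c₀ tie P (e :: h) = costA c₀ tie P h := by
  constructor
  · rw [recoloredA_cons, hA, changed_self, Finset.union_empty]
  · intro P
    rw [costA, hA, changed_self, Finset.inter_empty, Finset.card_empty, add_zero]

end Recoloring

namespace Recoloring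

open scoped Classical

/-! ### The potential -/

/-- How often a component can still grow by the factor `5 / 4` before its size exceeds `5 * D`. -/
noncomputable def growth (D n : ℝ) : ℝ := Real.log (min n (5 * D)) / Real.log (5 / 4)

/-- The potential of a component with `n` vertices, `r` of which were recolored. -/
noncomputable def pot (D α n r : ℝ) : ℝ :=
  r * growth D n + 10 / (1 - α) * r - 8 / (1 - α) * max 0 (r - (1 + α) / 2 * n)

theorem log_five_fourths_pos : 0 < Real.log (5 / 4 : ℝ) := Real.log_pos (by norm_num)

theorem growth_nonneg {D n : ℝ} (hD : 1 ≤ D) (hn : 1 ≤ n) : 0 ≤ growth D n :=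
  div_nonneg (Real.log_nonneg (le_min hn (by linarith))) log_five_fourths_pos.le

theorem growth_mono {D n m : ℝ} (hD : 1 ≤ D) (hn : 1 ≤ n) (hnm : n ≤ m) :
    growth D n ≤ growth D m := by
  refine div_le_div_of_nonneg_right (Real.log_le_log ?_ ?_) log_five_fourths_pos.le
  · exact lt_min (by linarith) (by linarith)
  · exact min_le_min_right _ hnm

/-- The cap `5 * D` is chosen so that a component of size at most `4 * D` can grow by `5 / 4`
without reaching beyond it. -/
theorem growth_add_one_le {D n m : ℝ} (hn : 1 ≤ n) (hnD : n ≤ 4 * D) (hnm : 5 / 4 * n ≤ m) :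
    growth D n + 1 ≤ growth D m := by
  have h0 := log_five_fourths_pos
  rw [growth, growth, div_add_one h0.ne']
  refine div_le_div_of_nonneg_right ?_ h0.le
  rw [min_eq_left (by linarith), ← Real.log_mul (by linarith) (by norm_num)]
  exact Real.log_le_log (by linarith) (le_min (by linarith) (by linarith))

theorem growth_le {D n : ℝ} (hD : 1 ≤ D) (hn : 1 ≤ n) :
    growth D n ≤ (Real.log 5 + Real.log D) / Real.log (5 / 4) := by
  rw [← Real.log_mul (by norm_num) (by linarith)]
  refine div_le_div_of_nonneg_right (Real.log_le_log ?_ (min_le_right _ _))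
    log_five_fourths_pos.le
  exact lt_min (by linarith) (by linarith)

section

variable {D α x y rx ry : ℝ}

theorem pot_le (hα : α < 1) (hD : 1 ≤ D) (hx : 1 ≤ x) (hrx : 0 ≤ rx) :
    pot D α x rx ≤ rx * ((Real.log 5 + Real.log D) / Real.log (5 / 4) + 10 / (1 - α)) := by
  have h1 := mul_le_mul_of_nonneg_left (growth_le hD hx) hrx
  have h2 : 0 ≤ 8 / (1 - α) * max 0 (rx - (1 + α) / 2 * x) :=
    mul_nonneg (div_nonneg (by norm_num) (by linarith)) (le_max_left _ _)
  rw [pot]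
  linarith

/-- The growth factor is monotone in the size, and the excess, which enters negatively, is
subadditive as the positive part of a linear function. -/
theorem pot_add_le (hα : α < 1) (hD : 1 ≤ D) (hx : 1 ≤ x) (hy : 1 ≤ y) (hrx : 0 ≤ rx)
    (hry : 0 ≤ ry) : pot D α x rx + pot D α y ry ≤ pot D α (x + y) (rx + ry) := by
  have h1 := mul_le_mul_of_nonneg_left (growth_mono (m := x + y) hD hx (by linarith)) hrx
  have h2 := mul_le_mul_of_nonneg_left (growth_mono (m := x + y) hD hy (by linarith)) hry
  have h3 : max 0 (rx + ry - (1 + α) / 2 * (x + y)) ≤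
      max 0 (rx - (1 + α) / 2 * x) + max 0 (ry - (1 + α) / 2 * y) := by
    refine max_le (add_nonneg (le_max_left _ _) (le_max_left _ _)) ?_
    have := le_max_right 0 (rx - (1 + α) / 2 * x)
    have := le_max_right 0 (ry - (1 + α) / 2 * y)
    linarith
  have h4 := mul_le_mul_of_nonneg_left h3 (div_nonneg (a := 8) (by norm_num) (sub_nonneg.2 hα.le))
  simp only [pot]
  linarith

/-- Each newly recolored vertex adds `10 / (1 - α)` to the linear term and at most `8 / (1 - α)` to
the subtracted excess term. -/
theorem pot_add_le_pot_self (hα : α < 1) (hD : 1 ≤ D) (hx : 1 ≤ x) (hrx : rx ≤ x) :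
    pot D α x rx + 2 / (1 - α) * (x - rx) ≤ pot D α x x := by
  have h1 := mul_le_mul_of_nonneg_right hrx (growth_nonneg hD hx)
  have h3 : max 0 (x - (1 + α) / 2 * x) ≤ max 0 (rx - (1 + α) / 2 * x) + (x - rx) := by
    refine max_le (add_nonneg (le_max_left _ _) (by linarith)) ?_
    have := le_max_right 0 (rx - (1 + α) / 2 * x)
    linarith
  have h4 := mul_le_mul_of_nonneg_left h3 (div_nonneg (a := 8) (by norm_num) (sub_nonneg.2 hα.le))
  have h5 : (10 : ℝ) / (1 - α) = 8 / (1 - α) + 2 / (1 - α) := by ring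
  simp only [pot]
  rw [h5]
  linarith

/-- Recoloring a whole component before merging it does not decrease the potential. -/
theorem pot_add_le_flip (hα : α < 1) (hD : 1 ≤ D) (hx : 1 ≤ x) (hy : 1 ≤ y)
    (hrx' : rx ≤ x) (hry : 0 ≤ ry) :
    pot D α x rx + pot D α y ry ≤ pot D α (x + y) (x + ry) := by
  have h1 := pot_add_le_pot_self hα hD hx hrx'
  have h2 : 0 ≤ 2 / (1 - α) * (x - rx) :=
    mul_nonneg (div_nonneg (by norm_num) (by linarith)) (by linarith)
  have h3 := pot_add_le (α := α) (rx := x) hα hD hx hy (by linarith) hry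
  linarith

/-- The potential pays for recoloring a component that is not much larger than the other one. -/
theorem pot_add_add_le_flip (hα : α < 1) (hD : 1 ≤ D) (hx : 1 ≤ x) (hy : 1 ≤ y)
    (hrx' : rx ≤ x) (hry : 0 ≤ ry) (hxy : x ≤ 4 * y)
    (hmod : x ≤ D ∨ y ≤ D ∨ rx ≤ α * x ∨ ry ≤ α * y) :
    pot D α x rx + pot D α y ry + x ≤ pot D α (x + y) (x + ry) := by
  have hα' : 0 < 1 - α := by linarith
  have h1 := pot_add_le_pot_self hα hD hx hrx'
  have h2 : 0 ≤ 2 / (1 - α) * (x - rx) :=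
    mul_nonneg (div_nonneg (by norm_num) hα'.le) (by linarith)
  -- If the flipped component is light, at least `(1 - α) * x` vertices are recolored for the first
  -- time, and each gains `2 / (1 - α)`: in total `2 * x`.
  by_cases hlight : rx ≤ α * x
  · have h3 := pot_add_le (α := α) (rx := x) hα hD hx hy (by linarith) hry
    have h4 : 2 / (1 - α) * (x - rx) ≥ 2 / (1 - α) * ((1 - α) * x) :=
      mul_le_mul_of_nonneg_left (by linarith) (div_nonneg (by norm_num) hα'.le)
    rw [← mul_assoc, div_mul_cancel₀ _ hα'.ne'] at h4
    linarith
  suffices pot D α x x + pot D α y ry + x ≤ pot D α (x + y) (x + ry) by linarith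
  -- Fully recolored, the first component has excess `(1 - α) / 2 * x`. Merging with a light one of
  -- size at least `x / 4` removes at least a quarter of it, and the factor `8 / (1 - α)` turns this
  -- into a gain of `x`.
  by_cases hlight' : ry ≤ α * y
  · have h3 := mul_le_mul_of_nonneg_left (growth_mono (m := x + y) hD hx (by linarith))
      (by linarith : 0 ≤ x)
    have h4 := mul_le_mul_of_nonneg_left (growth_mono (m := x + y) hD hy (by linarith)) hry
    have h5 : max 0 (x + ry - (1 + α) / 2 * (x + y)) ≤ 3 / 4 * ((1 - α) / 2 * x) := by
      have hx0 : 0 ≤ (1 - α) * x := mul_nonneg hα'.le (by linarith)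
      refine max_le (by linarith) ?_
      have : (1 - α) * x ≤ (1 - α) * (4 * y) := mul_le_mul_of_nonneg_left hxy hα'.le
      linarith
    have h6 : (1 - α) / 2 * x ≤ max 0 (x - (1 + α) / 2 * x) :=
      le_trans (le_of_eq (by ring)) (le_max_right _ _)
    have h7 := mul_le_mul_of_nonneg_left h5 (div_nonneg (a := 8) (by norm_num) hα'.le)
    have h8 := mul_le_mul_of_nonneg_left h6 (div_nonneg (a := 8) (by norm_num) hα'.le)
    have h9 : 8 / (1 - α) * ((1 - α) / 2 * x) = 4 * x := by field_simp; norm_num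
    have h10 : 0 ≤ 8 / (1 - α) * max 0 (ry - (1 + α) / 2 * y) :=
      mul_nonneg (div_nonneg (by norm_num) hα'.le) (le_max_left _ _)
    simp only [pot]
    linarith
  -- With both heavy, one is small, and `x ≤ 4 * y` bounds `x` in either case. The merged size is at
  -- least `5 / 4 * x`, so each of the `x` recolored vertices gains one unit of growth.
  · have hxD : x ≤ 4 * D := by
      rcases hmod with h | h | h | h
      · linarith
      · linarith
      · exact absurd h hlight
      · exact absurd h hlight'
    have h3 := mul_le_mul_of_nonneg_left
      (growth_add_one_le (m := x + y) hx hxD (by linarith)) (by linarith : 0 ≤ x)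
    have h4 := mul_le_mul_of_nonneg_left (growth_mono (m := x + y) hD hy (by linarith)) hry
    have h5 : max 0 (x + ry - (1 + α) / 2 * (x + y)) ≤
        max 0 (x - (1 + α) / 2 * x) + max 0 (ry - (1 + α) / 2 * y) := by
      refine max_le (add_nonneg (le_max_left _ _) (le_max_left _ _)) ?_
      have := le_max_right 0 (x - (1 + α) / 2 * x)
      have := le_max_right 0 (ry - (1 + α) / 2 * y)
      linarith
    have h6 := mul_le_mul_of_nonneg_left h5 (div_nonneg (a := 8) (by norm_num) hα'.le)
    simp only [pot]
    linarith

end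

/-! ### The cost of algorithm A -/

variable {V : Type*}

theorem card_inter_union_left {X Y R : Finset V} (hXY : Disjoint X Y) :
    ((R ∪ X) ∩ (X ∪ Y)).card = X.card + (R ∩ Y).card := by
  have : (R ∪ X) ∩ (X ∪ Y) = X ∪ (R ∩ Y) := by
    ext w
    simp only [Finset.mem_inter, Finset.mem_union]
    tauto
  rw [this, Finset.card_union_of_disjoint (hXY.mono_right Finset.inter_subset_right)]

theorem card_inter_union_of_disjoint {X Y R : Finset V} (hXY : Disjoint X Y) :
    (R ∩ (X ∪ Y)).card = (R ∩ X).card + (R ∩ Y).card := by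
  rw [Finset.inter_comm, card_union_inter hXY, Finset.inter_comm X, Finset.inter_comm Y]

theorem union_inter_of_disjoint {X P R : Finset V} (hXP : Disjoint P X) :
    (R ∪ X) ∩ P = R ∩ P := by
  rw [Finset.union_inter_distrib_right, Finset.inter_comm X,
    Finset.disjoint_iff_inter_eq_empty.1 hXP, Finset.union_empty]

variable [Fintype V]

theorem isLight_iff {α : ℝ} {R : Finset V} {h : List (V × V)} {v : V} :
    IsLight α R (comp h v) ↔ ((R ∩ comp h v).card : ℝ) ≤ α * (comp h v).card := by
  rw [IsLight, div_le_iff₀ (by exact_mod_cast card_comp_pos h v)]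

/-- Six units are deposited on each displaced vertex. A flip with `|X| ≤ 4|Y|` costs `|X|` and adds
at most `6|X|` to the deposit, paid by seven times the gain in potential. Any other flip lowers the
displaced count by at least `|X| / 6`, so the deposit pays, and the potential need only not
decrease. -/
theorem costA_comp_le {D α : ℝ} (hα₀ : 0 < α) (hα : α < 1) (hD : 1 ≤ D) (c₀ : V → Bool)
    (tie : List (V × V) → Bool) {col : V → Bool} :
    ∀ {h : List (V × V)}, (∀ e ∈ h, e.1 ≠ e.2) → IsValid (seqGraph h) col →
      Moderate D α c₀ tie h → ∀ v,
      (costA c₀ tie (comp h v) h : ℝ) + 6 * (comp h v ∩ changed c₀ (colA c₀ tie h)).card ≤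
        7 * pot D α (comp h v).card (recoloredA c₀ tie h ∩ comp h v).card
  | [], _, _, _ => fun v => by
    have h1 : max 0 (0 - (1 + α) / 2 * ((comp ([] : List (V × V)) v).card : ℝ)) = 0 :=
      max_eq_left (sub_nonpos.2 (mul_nonneg (by linarith) (Nat.cast_nonneg _)))
    simp [costA, colA, changed_self, recoloredA, pot, -zero_sub, h1]
  | e :: h, hl, hcol, hmod => by
    have he := hl e (by simp)
    have hl' : ∀ e ∈ h, e.1 ≠ e.2 := fun e' he' => hl e' (List.mem_cons_of_mem _ he')
    have hcol' := hcol.mono (seqGraph_le_cons e h)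
    have ih := costA_comp_le hα₀ hα hD c₀ tie hl' hcol' hmod.1
    obtain ⟨hv, -⟩ := colA_spec c₀ tie hl' hcol'
    intro v
    have hpos : ∀ w, (1 : ℝ) ≤ (comp h w).card := fun w => by exact_mod_cast card_comp_pos h w
    by_cases hce : colA c₀ tie h e.1 = colA c₀ tie h e.2
    · obtain ⟨hr, X, Y, hXY, hd, hC, hA, -, hcase⟩ := colA_cons_of_eq hcol he hv hce
      obtain ⟨hR, hcost⟩ := flip_step hA
      rcases comp_cons_cases e h v with ⟨h1, h2 | h2⟩ | ⟨h1, -⟩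
      · exact absurd h2 hr
      · have hdX : Disjoint (comp h v) X := by
          rw [hC] at h2
          exact h2.mono_right Finset.subset_union_left
        rw [h1, hcost, hR, union_inter_of_disjoint hdX, hA,
          inter_changed_flip_of_disjoint hdX.symm, Finset.disjoint_iff_inter_eq_empty.1 hdX]
        simpa using ih v
      · rw [h1, hC, hcost, hR, costA_union c₀ tie hd, card_inter_union_left hd,
          Finset.card_union_of_disjoint hd,
          Finset.inter_eq_right.2 (Finset.subset_union_left : X ⊆ X ∪ Y)]
        have hX : 1 ≤ (X.card : ℝ) ∧ 1 ≤ (Y.card : ℝ) := by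
          rcases hXY with ⟨rfl, rfl⟩ | ⟨rfl, rfl⟩ <;> exact ⟨hpos _, hpos _⟩
        have hrX : ((recoloredA c₀ tie h ∩ X).card : ℝ) ≤ X.card := by
          exact_mod_cast Finset.card_le_card Finset.inter_subset_right
        have hm := hmod.2 hr
        simp only [IsSmall, isLight_iff] at hm
        have ih' : (costA c₀ tie X h : ℝ) + 6 * (X ∩ changed c₀ (colA c₀ tie h)).card ≤
              7 * pot D α X.card (recoloredA c₀ tie h ∩ X).card ∧
            (costA c₀ tie Y h : ℝ) + 6 * (Y ∩ changed c₀ (colA c₀ tie h)).card ≤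
              7 * pot D α Y.card (recoloredA c₀ tie h ∩ Y).card := by
          rcases hXY with ⟨rfl, rfl⟩ | ⟨rfl, rfl⟩ <;> exact ⟨ih _, ih _⟩
        have hold := card_union_inter hd (changed c₀ (colA c₀ tie h))
        have hnew := card_union_inter hd (changed c₀ (colA c₀ tie (e :: h)))
        push_cast
        rcases hcase with hcase | hcase
        · have hpot := pot_add_add_le_flip hα hD hX.1 hX.2 hrX
            (Nat.cast_nonneg (recoloredA c₀ tie h ∩ Y).card) (by exact_mod_cast hcase) (by
              rcases hXY with ⟨rfl, rfl⟩ | ⟨rfl, rfl⟩ <;> tauto)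
          have hn : (((X ∪ Y) ∩ changed c₀ (colA c₀ tie (e :: h))).card : ℝ) ≤
              X.card + (Y ∩ changed c₀ (colA c₀ tie h)).card := by
            rw [hA, inter_changed_flip_of_disjoint hd, ← hA] at hnew
            rw [hnew]
            push_cast
            gcongr
            exact Finset.inter_subset_left
          linarith [Nat.cast_nonneg (α := ℝ) (X ∩ changed c₀ (colA c₀ tie h)).card]
        · have hpot := pot_add_le_flip (α := α) hα hD hX.1 hX.2 hrX
            (Nat.cast_nonneg (recoloredA c₀ tie h ∩ Y).card)
          rw [hold] at hcase
          have hcase' : (6 : ℝ) * ((X ∪ Y) ∩ changed c₀ (colA c₀ tie (e :: h))).card + X.card ≤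
            6 * ((X ∩ changed c₀ (colA c₀ tie h)).card +
              (Y ∩ changed c₀ (colA c₀ tie h)).card) := by exact_mod_cast hcase
          linarith
    · have hA := colA_cons_of_ne hce
      obtain ⟨hR, hcost⟩ := stay_step hA
      rw [hR, hcost, hA]
      rcases comp_cons_cases e h v with ⟨h1, -⟩ | ⟨h1, h2⟩
      · rw [h1]; exact ih v
      · have hd := disjoint_comp h2
        rw [h1, costA_union c₀ tie hd, card_union_inter hd, card_inter_union_of_disjoint hd,
          Finset.card_union_of_disjoint hd]
        push_cast
        have hpot := pot_add_le (α := α) hα hD (hpos e.1) (hpos e.2)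
          (Nat.cast_nonneg (recoloredA c₀ tie h ∩ comp h e.1).card)
          (Nat.cast_nonneg (recoloredA c₀ tie h ∩ comp h e.2).card)
        linarith [ih e.1, ih e.2]

theorem comp_eq_filter (h : List (V × V)) (v : V) :
    comp h v = Finset.univ.filter fun w =>
      (seqGraph h).connectedComponentMk w = (seqGraph h).connectedComponentMk v := by
  ext w
  simp only [mem_comp, Finset.mem_filter, Finset.mem_univ, true_and,
    SimpleGraph.ConnectedComponent.eq]
  exact ⟨SimpleGraph.Reachable.symm, SimpleGraph.Reachable.symm⟩

/-- The partition comes from a fixed sequence `H`, separate from the history `h`, so that induction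
on `h` does not change it. -/
theorem costA_eq_sum (c₀ : V → Bool) (tie : List (V × V) → Bool) (H : List (V × V)) :
    ∀ h, costA c₀ tie Finset.univ h = ∑ C : (seqGraph H).ConnectedComponent,
      costA c₀ tie (Finset.univ.filter fun w => (seqGraph H).connectedComponentMk w = C) h
  | [] => by simp [costA]
  | e :: h => by
    simp only [costA]
    rw [Finset.sum_add_distrib, ← costA_eq_sum c₀ tie H h, Finset.univ_inter,
      Finset.card_eq_sum_card_fiberwise (f := (seqGraph H).connectedComponentMk)
        (t := Finset.univ) (fun _ _ => Finset.mem_coe.2 (Finset.mem_univ _))]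
    congr 1
    refine Finset.sum_congr rfl fun C _ => ?_
    congr 1
    ext w
    simp [and_comm]

theorem sum_card_inter (R : Finset V) (h : List (V × V)) :
    ∑ C : (seqGraph h).ConnectedComponent,
      (R ∩ Finset.univ.filter fun w => (seqGraph h).connectedComponentMk w = C).card = R.card := by
  rw [Finset.card_eq_sum_card_fiberwise (s := R) (f := (seqGraph h).connectedComponentMk)
        (t := Finset.univ) (fun _ _ => Finset.mem_coe.2 (Finset.mem_univ _))]
  refine Finset.sum_congr rfl fun C _ => ?_
  congr 1
  ext w
  simp

/-- The cost of algorithm A on a moderate sequence. -/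
theorem costA_le {D α : ℝ} (hα₀ : 0 < α) (hα : α < 1) (hD : 1 ≤ D) (c₀ : V → Bool)
    (tie : List (V × V) → Bool) {col : V → Bool} {h : List (V × V)} (hl : ∀ e ∈ h, e.1 ≠ e.2)
    (hcol : IsValid (seqGraph h) col) (hmod : Moderate D α c₀ tie h) :
    (costA c₀ tie Finset.univ h : ℝ) ≤ (recoloredA c₀ tie h).card *
      (7 * ((Real.log 5 + Real.log D) / Real.log (5 / 4) + 10 / (1 - α))) := by
  rw [costA_eq_sum c₀ tie h, ← sum_card_inter (recoloredA c₀ tie h) h]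
  push_cast
  rw [Finset.sum_mul]
  refine Finset.sum_le_sum fun C _ => ?_
  obtain ⟨v, rfl⟩ := C.exists_rep
  have h1 := costA_comp_le hα₀ hα hD c₀ tie hl hcol hmod v
  have h2 := pot_le (D := D) (x := (comp h v).card) hα hD
    (by exact_mod_cast card_comp_pos h v)
    (Nat.cast_nonneg (recoloredA c₀ tie h ∩ comp h v).card)
  have h3 := Nat.cast_nonneg (α := ℝ) (comp h v ∩ changed c₀ (colA c₀ tie h)).card
  rw [comp_eq_filter] at h1 h2 h3
  change (costA c₀ tie (Finset.univ.filter fun w => (seqGraph h).connectedComponentMk w =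
    (seqGraph h).connectedComponentMk v) h : ℝ) ≤ (recoloredA c₀ tie h ∩ Finset.univ.filter fun w =>
      (seqGraph h).connectedComponentMk w = (seqGraph h).connectedComponentMk v).card * _
  linarith

end Recoloring

namespace Recoloring

open scoped Classical

variable {V : Type*}

/-- Switching to `col` at the first arrival suffices. It ensures that the infimum in `opt` is
attained rather than being the default value `0` of an empty set. -/
theorem exists_isOfflineSolution (c₀ : V → Bool) {col : V → Bool} {σ : List (V × V)}
    (hcol : IsValid (seqGraph σ) col) : ∃ f, IsOfflineSolution c₀ σ f := by
  refine ⟨fun h => if h = [] then c₀ else col, if_pos rfl, ?_⟩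
  intro h hh
  by_cases hnil : h = []
  · subst hnil
    intro a b hab
    simp [seqGraph_nil] at hab
  · simp only [hnil, if_false]
    exact hcol.mono (seqGraph_mono fun e he => hh.subset he)

variable [Fintype V]

/-! ### The simulated sequence -/

section

variable {D α : ℝ} {c₀ : V → Bool} {tie : List (V × V) → Bool} {e : V × V} {h : List (V × V)}

theorem simSeq_cons_of_moderate (hm : Moderate D α c₀ tie (e :: simSeq D α c₀ tie h)) :
    simSeq D α c₀ tie (e :: h) = e :: simSeq D α c₀ tie h := by rw [simSeq, if_pos hm]

theorem simSeq_cons_of_not_moderate (hm : ¬ Moderate D α c₀ tie (e :: simSeq D α c₀ tie h)) :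
    simSeq D α c₀ tie (e :: h) = simSeq D α c₀ tie h := by rw [simSeq, if_neg hm]

end

variable (D α : ℝ) (c₀ : V → Bool) (tie : List (V × V) → Bool)

theorem moderate_simSeq : ∀ h, Moderate D α c₀ tie (simSeq D α c₀ tie h)
  | [] => trivial
  | e :: h => by
    by_cases hm : Moderate D α c₀ tie (e :: simSeq D α c₀ tie h)
    · rwa [simSeq_cons_of_moderate hm]
    · rw [simSeq_cons_of_not_moderate hm]
      exact moderate_simSeq h

theorem mem_of_mem_simSeq : ∀ h, ∀ e ∈ simSeq D α c₀ tie h, e ∈ h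
  | [], _, h => h
  | e' :: h, e, he => by
    by_cases hm : Moderate D α c₀ tie (e' :: simSeq D α c₀ tie h)
    · rw [simSeq_cons_of_moderate hm, List.mem_cons] at he
      exact List.mem_cons.2 (he.imp_right (mem_of_mem_simSeq h e))
    · rw [simSeq_cons_of_not_moderate hm] at he
      exact List.mem_cons_of_mem _ (mem_of_mem_simSeq h e he)

theorem seqGraph_simSeq_le (h : List (V × V)) : seqGraph (simSeq D α c₀ tie h) ≤ seqGraph h :=
  seqGraph_mono (mem_of_mem_simSeq D α c₀ tie h)

theorem recoloredSim_mono (e : V × V) (h : List (V × V)) :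
    recoloredSim D α c₀ tie h ⊆ recoloredSim D α c₀ tie (e :: h) := by
  by_cases hm : Moderate D α c₀ tie (e :: simSeq D α c₀ tie h)
  · rw [recoloredSim, recoloredSim, simSeq_cons_of_moderate hm, recoloredA_cons]
    exact Finset.subset_union_left
  · rw [recoloredSim, recoloredSim, simSeq_cons_of_not_moderate hm]

/-! ### Comparison with offline solutions -/

/-- The set of vertices ever recolored by an offline solution. -/
noncomputable def touched (f : List (V × V) → V → Bool) : List (V × V) → Finset V
  | [] => ∅
  | e :: h => touched f h ∪ changed (f h) (f (e :: h))

theorem card_touched_le (f : List (V × V) → V → Bool) :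
    ∀ h, (touched f h).card ≤ recolorings f h
  | [] => le_rfl
  | _ :: h =>
    (Finset.card_union_le _ _).trans (Nat.add_le_add_right (card_touched_le f h) _)

theorem changed_subset_touched (f : List (V × V) → V → Bool) :
    ∀ h, changed (f []) (f h) ⊆ touched f h
  | [] => by rw [changed_self]; exact Finset.empty_subset _
  | e :: h => by
    intro w hw
    rw [touched, Finset.mem_union]
    by_cases hw' : f [] w = f h w
    · right
      rw [mem_changed] at hw ⊢
      rwa [← hw']
    · exact Or.inl (changed_subset_touched f h (mem_changed.2 hw'))

/-- The bound is local to simulated components: `f` is valid for all edges, hence for those of the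
simulation, so on each component it is comparable with the coloring of algorithm A. -/
theorem card_recolored_inter_comp_le {f : List (V × V) → V → Bool} (hf : f [] = c₀) :
    ∀ {h : List (V × V)}, (∀ e ∈ h, e.1 ≠ e.2) →
      (∀ h', h' <:+ h → IsValid (seqGraph h') (f h')) → ∀ v,
      (recoloredSim D α c₀ tie h ∩ comp (simSeq D α c₀ tie h) v).card ≤
        3 * (touched f h ∩ comp (simSeq D α c₀ tie h) v).card
  | [], _, _, v => by simp [recoloredSim, simSeq, recoloredA]
  | e :: h, hl, hval, v => by
    have he := hl e (by simp)
    have hl' : ∀ e ∈ h, e.1 ≠ e.2 := fun e' he' => hl e' (List.mem_cons_of_mem _ he')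
    have ih := card_recolored_inter_comp_le hf hl'
      (fun h' hh' => hval h' (hh'.trans (List.suffix_cons _ _)))
    have hT : ∀ P, (touched f h ∩ P).card ≤ (touched f (e :: h) ∩ P).card := fun P =>
      Finset.card_le_card (Finset.inter_subset_inter_right Finset.subset_union_left)
    unfold recoloredSim at ih ⊢
    by_cases hm : Moderate D α c₀ tie (e :: simSeq D α c₀ tie h)
    swap
    · rw [simSeq_cons_of_not_moderate hm]
      exact (ih v).trans (Nat.mul_le_mul_left _ (hT _))
    have hsub := seqGraph_simSeq_le D α c₀ tie (e :: h)
    have hls := fun e' he' => hl' e' (mem_of_mem_simSeq D α c₀ tie h e' he')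
    rw [simSeq_cons_of_moderate hm] at hsub ⊢
    generalize simSeq D α c₀ tie h = s at *
    have hcol := (hval _ List.suffix_rfl).mono hsub
    have hcol' := hcol.mono (seqGraph_le_cons e s)
    obtain ⟨hv, hb⟩ := colA_spec c₀ tie hls hcol'
    by_cases hce : colA c₀ tie s e.1 = colA c₀ tie s e.2
    · obtain ⟨hr, X, Y, hXY, hd, hC, hA, h23, -⟩ := colA_cons_of_eq hcol he hv hce
      obtain ⟨hR, -⟩ := flip_step hA
      rcases comp_cons_cases e s v with ⟨h1, h2 | h2⟩ | ⟨h1, -⟩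
      · exact absurd h2 hr
      · have hdX : Disjoint (comp s v) X := by
          rw [hC] at h2
          exact h2.mono_right Finset.subset_union_left
        rw [h1, hR, union_inter_of_disjoint hdX]
        exact (ih v).trans (Nat.mul_le_mul_left _ (hT _))
      · have hv' := (colA_spec c₀ tie (h := e :: s)
          (by simpa using ⟨he, fun a b hab => hls (a, b) hab⟩) hcol).1
        have hreach : ∀ w ∈ X ∪ Y, (seqGraph (e :: s)).Reachable e.1 w := by
          intro w hw
          rwa [← hC, ← comp_cons_left, mem_comp] at hw
        have ihY : (recoloredA c₀ tie s ∩ Y).card ≤ 3 * (touched f (e :: h) ∩ Y).card := by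
          rcases hXY with ⟨rfl, rfl⟩ | ⟨rfl, rfl⟩ <;>
            exact (ih _).trans (Nat.mul_le_mul_left _ (hT _))
        have hbX : 3 * (X ∩ changed c₀ (colA c₀ tie s)).card ≤ 2 * X.card := by
          rcases hXY with ⟨rfl, rfl⟩ | ⟨rfl, rfl⟩ <;> exact hb _
        rw [h1, hC, hR, card_inter_union_left hd]
        have hch := changed_subset_touched f (e :: h)
        rw [hf] at hch
        have hcard : (X ∪ Y).card = X.card + Y.card := Finset.card_union_of_disjoint hd
        have hRY : (recoloredA c₀ tie s ∩ Y).card ≤ Y.card :=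
          Finset.card_le_card Finset.inter_subset_right
        -- If `f` agrees with A on the merged component, it has touched all displaced vertices of
        -- the flipped `X`; by balance before the flip these are at least a third of `X`, and
        -- induction handles `Y`.
        by_cases hf1 : f (e :: h) e.1 = colA c₀ tie (e :: s) e.1
        · have hXT : X ∩ changed c₀ (colA c₀ tie (e :: s)) ⊆ touched f (e :: h) ∩ X := by
            intro w hw
            rw [Finset.mem_inter] at hw
            have heq := (hcol.eq_iff_eq hv' (hreach w (Finset.mem_union_left _ hw.1))).1 hf1
            refine Finset.mem_inter.2 ⟨hch ?_, hw.1⟩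
            rw [mem_changed, heq]
            exact mem_changed.1 hw.2
          have h3 := Finset.card_le_card hXT
          have h4 := card_inter_changed_flip X c₀ (colA c₀ tie s)
          rw [← hA] at h4
          rw [card_inter_union_of_disjoint hd]
          omega
        -- If `f` is opposite to A, it has touched every vertex that has its initial color under A,
        -- at least a third of the merged component by the two-thirds rule.
        · have hCT : (X ∪ Y) \ changed c₀ (colA c₀ tie (e :: s)) ⊆
              touched f (e :: h) ∩ (X ∪ Y) := by
            intro w hw
            rw [Finset.mem_sdiff, mem_changed, not_not] at hw
            have heq := (hcol.eq_iff_eq hv' (hreach w hw.1)).not.1 hf1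
            refine Finset.mem_inter.2 ⟨hch ?_, hw.1⟩
            rw [mem_changed, hw.2]
            exact Ne.symm heq
          have h3 := Finset.card_le_card hCT
          have h4 := Finset.card_inter_add_card_sdiff (X ∪ Y) (changed c₀ (colA c₀ tie (e :: s)))
          omega
    · obtain ⟨hR, -⟩ := stay_step (colA_cons_of_ne hce)
      rw [hR]
      rcases comp_cons_cases e s v with ⟨h1, -⟩ | ⟨h1, h2⟩
      · rw [h1]
        exact (ih v).trans (Nat.mul_le_mul_left _ (hT _))
      · have hd := disjoint_comp h2
        rw [h1, card_inter_union_of_disjoint hd, card_inter_union_of_disjoint hd]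
        have := ih e.1
        have := ih e.2
        have := hT (comp s e.1)
        have := hT (comp s e.2)
        omega

/-- Every offline solution recolors at least a third of the vertices that the simulation of
algorithm A recolors. -/
theorem card_recoloredSim_le_opt {col : V → Bool} {σ : List (V × V)} (hl : ∀ e ∈ σ, e.1 ≠ e.2)
    (hcol : IsValid (seqGraph σ) col) :
    (recoloredSim D α c₀ tie σ).card ≤ 3 * opt c₀ σ := by
  have hne : {n : ℕ | ∃ f, IsOfflineSolution c₀ σ f ∧ recolorings f σ = n}.Nonempty := by
    obtain ⟨f, hf⟩ := exists_isOfflineSolution c₀ hcol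
    exact ⟨_, f, hf, rfl⟩
  obtain ⟨f, hf, hopt⟩ := Nat.sInf_mem hne
  rw [opt, ← hopt]
  refine le_trans ?_ (Nat.mul_le_mul_left 3 (card_touched_le f σ))
  rw [← sum_card_inter (recoloredSim D α c₀ tie σ) (simSeq D α c₀ tie σ),
    ← sum_card_inter (touched f σ) (simSeq D α c₀ tie σ), Finset.mul_sum]
  refine Finset.sum_le_sum fun C _ => ?_
  obtain ⟨v, rfl⟩ := C.exists_rep
  have h1 := card_recolored_inter_comp_le D α c₀ tie hf.1 hl hf.2 v
  rw [comp_eq_filter] at h1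
  exact h1

end Recoloring

namespace Recoloring

open scoped Classical

variable {V : Type*} [Fintype V]

/-! ### Rejected edges -/

/-- The edges that are not sent to the simulation of algorithm A. -/
noncomputable def rejected (D α : ℝ) (c₀ : V → Bool) (tie : List (V × V) → Bool) :
    List (V × V) → Finset (Sym2 V)
  | [] => ∅
  | e :: h =>
    if Moderate D α c₀ tie (e :: simSeq D α c₀ tie h) then rejected D α c₀ tie h
    else insert s(e.1, e.2) (rejected D α c₀ tie h)

/-- The number of recolored vertices in the simulated component of `v`. -/
noncomputable def recoloredCount (D α : ℝ) (c₀ : V → Bool) (tie : List (V × V) → Bool)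
    (h : List (V × V)) (v : V) : ℝ :=
  (recoloredSim D α c₀ tie h ∩ comp (simSeq D α c₀ tie h) v).card

/-- The rejected edges with both endpoints in the simulated component of `v`. -/
noncomputable def rejectedInside (D α : ℝ) (c₀ : V → Bool) (tie : List (V × V) → Bool)
    (h : List (V × V)) (v : V) : Finset (Sym2 V) :=
  (rejected D α c₀ tie h).filter fun x => ∀ a ∈ x, a ∈ comp (simSeq D α c₀ tie h) v

variable {D α : ℝ} {c₀ : V → Bool} {tie : List (V × V) → Bool}

theorem recoloredCount_mono (e : V × V) (h : List (V × V)) (v : V) :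
    recoloredCount D α c₀ tie h v ≤ recoloredCount D α c₀ tie (e :: h) v := by
  refine Nat.cast_le.2 (Finset.card_le_card
    (Finset.inter_subset_inter (recoloredSim_mono D α c₀ tie e h) ?_))
  intro w
  rw [mem_comp, mem_comp]
  refine (·.mono ?_)
  by_cases hm : Moderate D α c₀ tie (e :: simSeq D α c₀ tie h)
  · rw [simSeq_cons_of_moderate hm]
    exact seqGraph_le_cons _ _
  · rw [simSeq_cons_of_not_moderate hm]

theorem recoloredCount_eq {h : List (V × V)} {v w : V} (hw : w ∈ comp (simSeq D α c₀ tie h) v) :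
    recoloredCount D α c₀ tie h w = recoloredCount D α c₀ tie h v := by
  rw [recoloredCount, recoloredCount, comp_eq_of_mem hw]

/-- A heavy and large component `C` has more than `α|C| > αD` recolored vertices. -/
theorem not_moderate {e : V × V} {h : List (V × V)} (hα : 0 < α)
    (hm : ¬ Moderate D α c₀ tie (e :: simSeq D α c₀ tie h)) :
    ¬ (seqGraph (simSeq D α c₀ tie h)).Reachable e.1 e.2 ∧
      α * D < recoloredCount D α c₀ tie h e.1 ∧ α * D < recoloredCount D α c₀ tie h e.2 := by
  have h1 := Classical.not_imp.1 fun h' => hm ⟨moderate_simSeq D α c₀ tie h, h'⟩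
  have key : ∀ v, ¬ (IsSmall D (comp (simSeq D α c₀ tie h) v) ∨
      IsLight α (recoloredSim D α c₀ tie h) (comp (simSeq D α c₀ tie h) v)) →
      α * D < recoloredCount D α c₀ tie h v := by
    intro v hv
    rw [not_or, isLight_iff, IsSmall, not_le, not_le] at hv
    exact (mul_lt_mul_of_pos_left hv.1 hα).trans hv.2
  rw [not_or] at h1
  exact ⟨h1.1, key _ h1.2.1, key _ h1.2.2⟩

/-- Simulated components and the recolored set only grow, so the lower bound present at rejection
persists. -/
theorem rejected_spec (hα : 0 < α) : ∀ {h : List (V × V)}, (∀ e ∈ h, e.1 ≠ e.2) →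
    ∀ x ∈ rejected D α c₀ tie h, x ∈ (seqGraph h).edgeSet ∧
      ∀ a ∈ x, α * D < recoloredCount D α c₀ tie h a
  | [], _, x, hx => absurd hx (Finset.notMem_empty x)
  | e :: h, hl, x, hx => by
    have hold : x ∈ rejected D α c₀ tie h → x ∈ (seqGraph (e :: h)).edgeSet ∧
        ∀ a ∈ x, α * D < recoloredCount D α c₀ tie (e :: h) a := by
      intro hx'
      have h1 := rejected_spec hα (fun e' he' => hl e' (List.mem_cons_of_mem _ he')) x hx'
      exact ⟨SimpleGraph.edgeSet_mono (seqGraph_le_cons e h) h1.1,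
        fun a ha => (h1.2 a ha).trans_le (recoloredCount_mono e h a)⟩
    rw [rejected] at hx
    split_ifs at hx with hm
    · exact hold hx
    · rcases Finset.mem_insert.1 hx with rfl | hx
      · obtain ⟨-, h1, h2⟩ := not_moderate hα hm
        refine ⟨seqGraph_cons_adj.2 (Or.inr ⟨hl e (by simp), rfl⟩), fun a ha => ?_⟩
        rcases Sym2.mem_iff.1 ha with rfl | rfl
        · exact h1.trans_le (recoloredCount_mono e h _)
        · exact h2.trans_le (recoloredCount_mono e h _)
      · exact hold hx

theorem rejectedInside_eq_empty (hα : 0 < α) {h : List (V × V)} (hl : ∀ e ∈ h, e.1 ≠ e.2) {v : V}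
    (hv : ¬ α * D < recoloredCount D α c₀ tie h v) : rejectedInside D α c₀ tie h v = ∅ := by
  refine Finset.eq_empty_of_forall_notMem fun x hx => hv ?_
  obtain ⟨hx, hxv⟩ := Finset.mem_filter.1 hx
  have h1 := (rejected_spec hα hl x hx).2
  induction x with | _ a b
  rw [← recoloredCount_eq (hxv a (by simp))]
  exact h1 a (by simp)

/-- The number of rejected edges inside a simulated component. -/
theorem card_rejectedInside_le (hα : 0 < α) (hD : 1 ≤ D) {G : SimpleGraph V} {β : ℕ}
    (hβ : largestBond G ≤ β) : ∀ {h : List (V × V)}, (∀ e ∈ h, e.1 ≠ e.2) → seqGraph h ≤ G →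
      ∀ v, α * D < recoloredCount D α c₀ tie h v →
      α * D * (rejectedInside D α c₀ tie h v).card + β * (α * D) ≤
        β * recoloredCount D α c₀ tie h v
  | [], _, _, v, hv => by
    simp only [rejectedInside, rejected, Finset.filter_empty, Finset.card_empty, Nat.cast_zero,
      mul_zero, zero_add]
    exact mul_le_mul_of_nonneg_left hv.le (Nat.cast_nonneg β)
  | e :: h, hl, hG, v, hv => by
    have hl' : ∀ e ∈ h, e.1 ≠ e.2 := fun e' he' => hl e' (List.mem_cons_of_mem _ he')
    -- Bonds are measured in a fixed graph `G` containing all prefixes, so the same `β` serves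
    -- throughout the induction.
    have hG' := (seqGraph_le_cons e h).trans hG
    have ih := card_rejectedInside_le hα hD hβ hl' hG'
    have hq : 0 < α * D := mul_pos hα (by linarith)
    have hβ0 : (0 : ℝ) ≤ β := Nat.cast_nonneg β
    have hpos : ∀ w, 0 ≤ recoloredCount D α c₀ tie h w := fun w => Nat.cast_nonneg _
    have hsame : rejectedInside D α c₀ tie (e :: h) v = rejectedInside D α c₀ tie h v →
        α * D * (rejectedInside D α c₀ tie (e :: h) v).card + β * (α * D) ≤
          β * recoloredCount D α c₀ tie (e :: h) v := by
      intro hI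
      rw [hI]
      by_cases hv' : α * D < recoloredCount D α c₀ tie h v
      · exact (ih v hv').trans (mul_le_mul_of_nonneg_left (recoloredCount_mono e h v) hβ0)
      · rw [rejectedInside_eq_empty hα hl' hv', Finset.card_empty, Nat.cast_zero, mul_zero,
          zero_add]
        exact mul_le_mul_of_nonneg_left hv.le hβ0
    by_cases hm : Moderate D α c₀ tie (e :: simSeq D α c₀ tie h)
    · rcases comp_cons_cases e (simSeq D α c₀ tie h) v with ⟨h1, -⟩ | ⟨h1, h2⟩
      · apply hsame
        rw [rejectedInside, rejectedInside, simSeq_cons_of_moderate hm, h1, rejected, if_pos hm]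
      · have hr : recoloredCount D α c₀ tie h e.1 + recoloredCount D α c₀ tie h e.2 ≤
            recoloredCount D α c₀ tie (e :: h) v := by
          have hsub := recoloredSim_mono D α c₀ tie e h
          rw [recoloredCount, recoloredCount, recoloredCount, simSeq_cons_of_moderate hm, h1,
            card_inter_union_of_disjoint (disjoint_comp h2)]
          push_cast
          gcongr
        -- The rejected edges that become internal by this merge. There are at most `β`, matched by
        -- the summand `β * (α * D)`, which the two induction hypotheses supply twice and the goal
        -- needs once. If one side has at most `α * D` recolored vertices, no rejected edge touches
        -- it and `B` is empty.
        let B := (rejected D α c₀ tie h).filter fun x => ∃ a b, x = s(a, b) ∧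
          a ∈ comp (simSeq D α c₀ tie h) e.1 ∧ b ∈ comp (simSeq D α c₀ tie h) e.2
        have hcover : (rejectedInside D α c₀ tie (e :: h) v).card ≤
            (rejectedInside D α c₀ tie h e.1).card + (rejectedInside D α c₀ tie h e.2).card +
              B.card := by
          refine (Finset.card_le_card ?_).trans ((Finset.card_union_le _ _).trans
            (Nat.add_le_add_right (Finset.card_union_le _ _) _))
          intro x hx
          rw [rejectedInside, simSeq_cons_of_moderate hm, h1, rejected, if_pos hm,
            Finset.mem_filter] at hx
          obtain ⟨hx, hin⟩ := hx
          induction x with | _ a b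
          simp only [Sym2.mem_iff, forall_eq_or_imp, forall_eq, Finset.mem_union] at hin
          simp only [Finset.mem_union, rejectedInside, B, Finset.mem_filter, hx, true_and,
            Sym2.mem_iff, forall_eq_or_imp, forall_eq]
          rcases hin with ⟨ha | ha, hb | hb⟩
          · exact Or.inl (Or.inl ⟨ha, hb⟩)
          · exact Or.inr ⟨a, b, rfl, ha, hb⟩
          · exact Or.inr ⟨b, a, Sym2.eq_swap, hb, ha⟩
          · exact Or.inl (Or.inr ⟨ha, hb⟩)
        have hcover' : ((rejectedInside D α c₀ tie (e :: h) v).card : ℝ) ≤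
            (rejectedInside D α c₀ tie h e.1).card + (rejectedInside D α c₀ tie h e.2).card +
              B.card := by exact_mod_cast hcover
        have hmul := mul_le_mul_of_nonneg_left hcover' hq.le
        have hmul' := mul_le_mul_of_nonneg_left hr hβ0
        have hB : B.Nonempty → α * D < recoloredCount D α c₀ tie h e.1 ∧
            α * D < recoloredCount D α c₀ tie h e.2 := by
          rintro ⟨x, hx⟩
          obtain ⟨hx, a, b, rfl, ha, hb⟩ := Finset.mem_filter.1 hx
          have h3 := (rejected_spec hα hl' _ hx).2
          rw [← recoloredCount_eq ha, ← recoloredCount_eq hb]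
          exact ⟨h3 a (by simp), h3 b (by simp)⟩
        have hBcard : B.card ≤ β := by
          have hne : (seqGraph (simSeq D α c₀ tie h)).connectedComponentMk e.1 ≠
              (seqGraph (simSeq D α c₀ tie h)).connectedComponentMk e.2 :=
            fun h => h2 (SimpleGraph.ConnectedComponent.eq.1 h)
          have h3 := card_add_le_of_between ((seqGraph_simSeq_le D α c₀ tie h).trans hG') hβ _
            {(seqGraph (simSeq D α c₀ tie h)).connectedComponentMk e.1,
              (seqGraph (simSeq D α c₀ tie h)).connectedComponentMk e.2} B rfl (by simp) (by
            intro x hx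
            obtain ⟨hx, a, b, rfl, ha, hb⟩ := Finset.mem_filter.1 hx
            have ha' := SimpleGraph.ConnectedComponent.eq.2 (mem_comp.1 ha)
            have hb' := SimpleGraph.ConnectedComponent.eq.2 (mem_comp.1 hb)
            exact ⟨a, b, rfl, hG' (rejected_spec hα hl' _ hx).1, by simp [← ha'],
              by simp [← hb'], by rwa [← ha', ← hb']⟩)
          rw [Finset.card_pair hne] at h3
          omega
        have hBcard' : α * D * B.card ≤ α * D * β :=
          mul_le_mul_of_nonneg_left (by exact_mod_cast hBcard) hq.le
        have hβq := mul_nonneg hβ0 hq.le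
        have hpos1 := mul_nonneg hβ0 (hpos e.1)
        have hpos2 := mul_nonneg hβ0 (hpos e.2)
        by_cases hr1 : α * D < recoloredCount D α c₀ tie h e.1 <;>
          by_cases hr2 : α * D < recoloredCount D α c₀ tie h e.2
        · have := ih _ hr1
          have := ih _ hr2
          linarith
        all_goals
          have hB0 : B = ∅ := Finset.not_nonempty_iff_eq_empty.1 (by tauto)
          rw [hB0, Finset.card_empty, Nat.cast_zero] at hmul
        · have := ih _ hr1
          rw [rejectedInside_eq_empty hα hl' hr2, Finset.card_empty, Nat.cast_zero] at hmul
          linarith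
        · have := ih _ hr2
          rw [rejectedInside_eq_empty hα hl' hr1, Finset.card_empty, Nat.cast_zero] at hmul
          linarith
        · have := mul_le_mul_of_nonneg_left hv.le hβ0
          rw [rejectedInside_eq_empty hα hl' hr1, rejectedInside_eq_empty hα hl' hr2,
            Finset.card_empty, Nat.cast_zero] at hmul
          linarith
    · apply hsame
      obtain ⟨h2, -⟩ := not_moderate hα hm
      rw [rejectedInside, rejectedInside, simSeq_cons_of_not_moderate hm, rejected, if_neg hm,
        Finset.filter_insert, if_neg]
      intro hin
      have h3 := mem_comp.1 (hin e.1 (by simp))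
      have h4 := mem_comp.1 (hin e.2 (by simp))
      exact h2 (h3.symm.trans h4)

/-- The number of rejected edges. -/
theorem card_rejected_le (hα : 0 < α) (hD : 1 ≤ D) {h : List (V × V)} {β : ℕ}
    (hβ : largestBond (seqGraph h) ≤ β) (hl : ∀ e ∈ h, e.1 ≠ e.2) :
    α * D * (rejected D α c₀ tie h).card ≤ β * (recoloredSim D α c₀ tie h).card := by
  have hq : 0 < α * D := mul_pos hα (by linarith)
  have hβ0 : (0 : ℝ) ≤ β := Nat.cast_nonneg β
  set H := seqGraph (simSeq D α c₀ tie h) with hH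
  let fiber : H.ConnectedComponent → Finset V := fun C =>
    Finset.univ.filter fun w => H.connectedComponentMk w = C
  let Q : Finset H.ConnectedComponent := Finset.univ.filter fun C =>
    α * D < ((recoloredSim D α c₀ tie h ∩ fiber C).card : ℝ)
  let I : H.ConnectedComponent → Finset (Sym2 V) := fun C =>
    (rejected D α c₀ tie h).filter fun x => ∀ a ∈ x, a ∈ fiber C
  let B := (rejected D α c₀ tie h).filter fun x => ∃ a b, x = s(a, b) ∧
    H.connectedComponentMk a ≠ H.connectedComponentMk b
  have hfiber : ∀ v, fiber (H.connectedComponentMk v) = comp (simSeq D α c₀ tie h) v :=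
    fun v => (comp_eq_filter _ v).symm
  have hcount : ∀ v, ((recoloredSim D α c₀ tie h ∩ fiber (H.connectedComponentMk v)).card : ℝ) =
      recoloredCount D α c₀ tie h v := fun v => by rw [hfiber, recoloredCount]
  have hI : ∀ C ∈ Q, α * D * (I C).card + β * (α * D) ≤
      β * (recoloredSim D α c₀ tie h ∩ fiber C).card := by
    intro C hC
    obtain ⟨v, rfl⟩ := C.exists_rep
    have h1 : α * D < _ := (Finset.mem_filter.1 hC).2
    have h2 : I (H.connectedComponentMk v) = rejectedInside D α c₀ tie h v := by
      simp only [I, rejectedInside, hfiber]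
    change α * D * (I (H.connectedComponentMk v)).card + β * (α * D) ≤
      β * (recoloredSim D α c₀ tie h ∩ fiber (H.connectedComponentMk v)).card
    change α * D < ((recoloredSim D α c₀ tie h ∩ fiber (H.connectedComponentMk v)).card : ℝ) at h1
    rw [hcount] at h1 ⊢
    rw [h2]
    exact card_rejectedInside_le hα hD hβ hl le_rfl v h1
  have hmemQ : ∀ x ∈ rejected D α c₀ tie h, ∀ a ∈ x, H.connectedComponentMk a ∈ Q := by
    intro x hx a ha
    refine Finset.mem_filter.2 ⟨Finset.mem_univ _, ?_⟩
    rw [hcount]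
    exact (rejected_spec hα hl x hx).2 a ha
  rcases Finset.eq_empty_or_nonempty Q with hQ | hQ
  · have : rejected D α c₀ tie h = ∅ := by
      refine Finset.eq_empty_of_forall_notMem fun x hx => ?_
      induction x with | _ a b
      have := hmemQ _ hx a (by simp)
      simp [hQ] at this
    rw [this, Finset.card_empty, Nat.cast_zero, mul_zero]
    positivity
  -- At most `β (#Q - 1)` rejected edges run between components. The term `-β` for each `C ∈ Q` in
  -- the bound on internal edges cancels these when everything is summed.
  have hB : B.card + β ≤ β * Q.card := by
    refine card_add_le_of_between (seqGraph_simSeq_le D α c₀ tie h) hβ _ Q B rfl hQ ?_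
    intro x hx
    obtain ⟨hx, a, b, rfl, hab⟩ := Finset.mem_filter.1 hx
    exact ⟨a, b, rfl, (rejected_spec hα hl _ hx).1, hmemQ _ hx a (by simp),
      hmemQ _ hx b (by simp), hab⟩
  have hcover : (rejected D α c₀ tie h).card ≤ ∑ C ∈ Q, (I C).card + B.card := by
    refine (Finset.card_le_card (t := Q.biUnion I ∪ B) ?_).trans ((Finset.card_union_le _ _).trans
      (Nat.add_le_add_right Finset.card_biUnion_le _))
    intro x hx
    have hxQ := hmemQ x hx
    induction x with | _ a b
    by_cases hab : H.connectedComponentMk a = H.connectedComponentMk b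
    · refine Finset.mem_union_left _ (Finset.mem_biUnion.2 ⟨_, hxQ a (by simp), ?_⟩)
      simpa [I, fiber, hx] using SimpleGraph.ConnectedComponent.eq.1 hab.symm
    · exact Finset.mem_union_right _ (Finset.mem_filter.2 ⟨hx, a, b, rfl, hab⟩)
  have hsum := Finset.sum_le_sum hI
  rw [Finset.sum_add_distrib, Finset.sum_const, nsmul_eq_mul, ← Finset.mul_sum,
    ← Finset.mul_sum] at hsum
  have hR : ∑ C ∈ Q, ((recoloredSim D α c₀ tie h ∩ fiber C).card : ℝ) ≤
      (recoloredSim D α c₀ tie h).card := by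
    rw [← sum_card_inter (recoloredSim D α c₀ tie h) (simSeq D α c₀ tie h)]
    push_cast
    exact Finset.sum_le_univ_sum_of_nonneg fun _ => Nat.cast_nonneg _
  have hcover' : ((rejected D α c₀ tie h).card : ℝ) ≤ ∑ C ∈ Q, ((I C).card : ℝ) + B.card := by
    exact_mod_cast hcover
  have hB' : (B.card : ℝ) + β ≤ β * Q.card := by exact_mod_cast hB
  have m1 := mul_le_mul_of_nonneg_left hcover' hq.le
  have m2 := mul_le_mul_of_nonneg_left hB' hq.le
  have m3 := mul_le_mul_of_nonneg_left hR hβ0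
  have m4 := mul_nonneg hβ0 hq.le
  linarith

end Recoloring

namespace Recoloring

open scoped Classical

variable {V : Type*} [Fintype V]

/-! ### Algorithm B -/

variable {D α : ℝ} {Δ : ℕ} {c₀ : V → Bool} {tie : List (V × V) → Bool}
  {pick : List (V × V) → Finset (Fin (Δ + 1)) → Fin (Δ + 1)}

theorem mem_blocked {h : List (V × V)} {c : V → Color Δ} {u : V} {k : Fin (Δ + 1)} :
    k ∈ blocked h c u ↔ ∃ w, (seqGraph h).Adj u w ∧ c w = Sum.inr k := by
  simp [blocked]

theorem ncard_neighborSet_mono {G H : SimpleGraph V} (hGH : G ≤ H) (v : V) :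
    (G.neighborSet v).ncard ≤ (H.neighborSet v).ncard :=
  Set.ncard_le_ncard (fun _ hw => hGH hw) (Set.toFinite _)

theorem exists_notMem_blocked {h : List (V × V)} {u : V}
    (hΔ : ((seqGraph h).neighborSet u).ncard ≤ Δ) (c : V → Color Δ) : ∃ k, k ∉ blocked h c u := by
  by_contra! hall
  have hsub : (Set.univ : Set (Color Δ)) ∩ Set.range Sum.inr ⊆ c '' (seqGraph h).neighborSet u := by
    rintro _ ⟨-, k, rfl⟩
    obtain ⟨w, hw, hk⟩ := mem_blocked.1 (hall k)
    exact ⟨w, hw, hk⟩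
  have h1 := (Set.ncard_le_ncard hsub (Set.toFinite _)).trans (Set.ncard_image_le (Set.toFinite _))
  rw [Set.univ_inter, ← Set.image_univ, Set.ncard_image_of_injective _ Sum.inr_injective,
    Set.ncard_univ, Nat.card_eq_fintype_card, Fintype.card_fin] at h1
  omega

/-- The invariant of algorithm B: exactly the special vertices have special colors, the others are
colored as in the simulation, and there is no rejected edge between two vertices that are not
special. -/
structure IsConsistent (D α : ℝ) (c₀ : V → Bool) (tie : List (V × V) → Bool) (h : List (V × V))
    (s : StateB V Δ) : Prop where
  color_of_notMem : ∀ w ∉ s.special, s.color w = Sum.inl (colA c₀ tie (simSeq D α c₀ tie h) w)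
  color_of_mem : ∀ w ∈ s.special, ∃ k, s.color w = Sum.inr k
  valid : IsValid (seqGraph h) s.color
  adj : ∀ a b, (seqGraph h).Adj a b → a ∉ s.special → b ∉ s.special →
    (seqGraph (simSeq D α c₀ tie h)).Adj a b

/-- A step of algorithm B in which no vertex receives a new special color. -/
structure KeepStep (D α : ℝ) (c₀ : V → Bool) (tie : List (V × V) → Bool) (e : V × V)
    (h : List (V × V)) (s t : StateB V Δ) : Prop where
  special : t.special = s.special
  color_of_mem : ∀ w ∈ s.special, t.color w = s.color w
  color_of_notMem : ∀ w ∉ s.special,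
    t.color w = Sum.inl (colA c₀ tie (simSeq D α c₀ tie (e :: h)) w)
  ne : e.1 ∈ s.special → e.2 ∈ s.special → s.color e.1 ≠ s.color e.2
  moderate : e.1 ∉ s.special → e.2 ∉ s.special →
    Moderate D α c₀ tie (e :: simSeq D α c₀ tie h)

/-- A step of algorithm B in which the first endpoint of the edge receives a new special color. -/
structure RecolorStep (D α : ℝ) (c₀ : V → Bool) (tie : List (V × V) → Bool) (e : V × V)
    (h : List (V × V)) (s t : StateB V Δ) : Prop where
  special : t.special = insert e.1 s.special
  color_left : ∃ k, t.color e.1 = Sum.inr k ∧ ∀ w, (seqGraph (e :: h)).Adj e.1 w →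
    t.color w ≠ Sum.inr k
  color_of_mem : ∀ w ∈ s.special, w ≠ e.1 → t.color w = s.color w
  color_of_notMem : ∀ w ∉ s.special, w ≠ e.1 →
    t.color w = Sum.inl (colA c₀ tie (simSeq D α c₀ tie (e :: h)) w)
  reason : (e.1 ∈ s.special ∧ e.2 ∈ s.special ∧ s.color e.1 = s.color e.2) ∨
    (e.1 ∉ s.special ∧ e.2 ∉ s.special ∧ ¬ Moderate D α c₀ tie (e :: simSeq D α c₀ tie h))

theorem recolorSpecial_of_ne {h : List (V × V)} {c : V → Color Δ} {u w : V} (hw : w ≠ u) :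
    recolorSpecial pick h c u w = c w := Function.update_of_ne hw _ _

theorem recolorSpecial_self (hpick : ChoosesFree pick) {h : List (V × V)} {u : V}
    (hΔ : ((seqGraph h).neighborSet u).ncard ≤ Δ) (c : V → Color Δ) :
    ∃ k, recolorSpecial pick h c u u = Sum.inr k ∧
      ∀ w, (seqGraph h).Adj u w → recolorSpecial pick h c u w ≠ Sum.inr k := by
  refine ⟨_, Function.update_self _ _ _, fun w hw hk => ?_⟩
  rw [recolorSpecial_of_ne hw.ne'] at hk
  exact hpick h _ (exists_notMem_blocked hΔ c) (mem_blocked.2 ⟨w, hw, hk⟩)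

/-- All branches of the algorithm reduce to two kinds of step. By the invariant, vertices already
special have special colors, so a special endpoint with a basic color can only be `e.1`, just
marked; hence `e.1` is the only vertex ever given a special color in a step. -/
theorem runB_cons (hpick : ChoosesFree pick) {e : V × V} {h : List (V × V)}
    (hΔ : ∀ v, ((seqGraph (e :: h)).neighborSet v).ncard ≤ Δ)
    (hs : IsConsistent D α c₀ tie h (runB D α c₀ tie pick h)) :
    KeepStep D α c₀ tie e h (runB D α c₀ tie pick h) (runB D α c₀ tie pick (e :: h)) ∨
      RecolorStep D α c₀ tie e h (runB D α c₀ tie pick h) (runB D α c₀ tie pick (e :: h)) := by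
  rw [runB]
  generalize runB D α c₀ tie pick h = s at *
  by_cases hm : Moderate D α c₀ tie (e :: simSeq D α c₀ tie h)
  · simp only [if_pos hm]
    by_cases hc : e.1 ∈ s.special ∧ e.2 ∈ s.special ∧ s.color e.1 = s.color e.2
    · right
      obtain ⟨h1, h2, h3⟩ := hc
      refine ⟨?_, ?_, ?_, ?_, Or.inl ⟨h1, h2, h3⟩⟩
      · simp [recx, h1]
      · simp only [recx, h1, h2, h3, and_self, if_true]
        exact recolorSpecial_self hpick (hΔ _) _
      · intro w hw hne
        simp only [recx, h1, h2, h3, and_self, if_true]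
        rw [recolorSpecial_of_ne hne, if_pos hw]
      · intro w hw hne
        simp only [recx, h1, h2, h3, and_self, if_true]
        rw [recolorSpecial_of_ne hne, if_neg hw, simSeq_cons_of_moderate hm]
    · left
      have hcolor : (recx pick (e :: h) e.1 e.2 ⟨fun w => if w ∈ s.special then s.color w else
          Sum.inl (colA c₀ tie (e :: simSeq D α c₀ tie h) w), s.special⟩).color =
          fun w => if w ∈ s.special then s.color w else
            Sum.inl (colA c₀ tie (e :: simSeq D α c₀ tie h) w) := by
        by_cases h1 : e.1 ∈ s.special <;> by_cases h2 : e.2 ∈ s.special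
        · have h3 : s.color e.1 ≠ s.color e.2 := fun h3 => hc ⟨h1, h2, h3⟩
          simp [recx, h1, h2, h3]
        · obtain ⟨k, hk⟩ := hs.color_of_mem _ h1
          simp [recx, h1, h2, hk]
        · obtain ⟨k, hk⟩ := hs.color_of_mem _ h2
          simp [recx, h1, h2, hk]
        · simp [recx, h1, h2]
      refine ⟨rfl, ?_, ?_, fun h1 h2 h3 => hc ⟨h1, h2, h3⟩, fun _ _ => hm⟩
      · intro w hw
        rw [hcolor]
        simp only [if_pos hw]
      · intro w hw
        rw [hcolor, simSeq_cons_of_moderate hm]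
        simp only [if_neg hw]
  · have hsim := simSeq_cons_of_not_moderate hm
    simp only [if_neg hm]
    by_cases hn : e.1 ∉ s.special ∧ e.2 ∉ s.special
    · right
      rw [if_pos hn]
      have hc1 : s.color e.1 = _ := hs.color_of_notMem _ hn.1
      have hc2 : s.color e.2 = _ := hs.color_of_notMem _ hn.2
      have hcolor : (recx pick (e :: h) e.1 e.2 ⟨s.color, insert e.1 s.special⟩).color =
          recolorSpecial pick (e :: h) s.color e.1 := by
        by_cases he : e.2 = e.1
        · simp [recx, he]
        · simp [recx, hn.2, he, hc1]
      refine ⟨rfl, ?_, ?_, ?_, Or.inr ⟨hn.1, hn.2, hm⟩⟩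
      · rw [hcolor]
        exact recolorSpecial_self hpick (hΔ _) _
      · intro w _ hne
        rw [hcolor, recolorSpecial_of_ne hne]
      · intro w hw hne
        rw [hcolor, recolorSpecial_of_ne hne, hsim, hs.color_of_notMem w hw]
    · rw [if_neg hn]
      by_cases hc : e.1 ∈ s.special ∧ e.2 ∈ s.special ∧ s.color e.1 = s.color e.2
      · right
        obtain ⟨h1, h2, h3⟩ := hc
        refine ⟨?_, ?_, ?_, ?_, Or.inl ⟨h1, h2, h3⟩⟩
        · simp [recx, h1]
        · simp only [recx, h1, h2, h3, and_self, if_true]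
          exact recolorSpecial_self hpick (hΔ _) _
        · intro w _ hne
          simp only [recx, h1, h2, h3, and_self, if_true]
          rw [recolorSpecial_of_ne hne]
        · intro w hw hne
          simp only [recx, h1, h2, h3, and_self, if_true]
          rw [recolorSpecial_of_ne hne, hsim, hs.color_of_notMem w hw]
      · left
        have hcolor : (recx pick (e :: h) e.1 e.2 s).color = s.color := by
          by_cases h1 : e.1 ∈ s.special <;> by_cases h2 : e.2 ∈ s.special
          · have h3 : s.color e.1 ≠ s.color e.2 := fun h3 => hc ⟨h1, h2, h3⟩
            simp [recx, h1, h2, h3]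
          · obtain ⟨k, hk⟩ := hs.color_of_mem _ h1
            simp [recx, h1, h2, hk]
          · obtain ⟨k, hk⟩ := hs.color_of_mem _ h2
            simp [recx, h1, h2, hk]
          · exact absurd ⟨h1, h2⟩ hn
        refine ⟨rfl, ?_, ?_, fun h1 h2 h3 => hc ⟨h1, h2, h3⟩, fun h1 h2 => absurd ⟨h1, h2⟩ hn⟩
        · intro w _
          rw [hcolor]
        · intro w hw
          rw [hcolor, hsim, hs.color_of_notMem w hw]

/-- If the new edge has no special endpoint after the step, it must have been sent to the
simulation; older edges keep the property because special marks are never removed. -/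
theorem adj_step {e : V × V} {h : List (V × V)} {s t : StateB V Δ}
    (hs : IsConsistent D α c₀ tie h s) (hst : s.special ⊆ t.special)
    (hmod : e.1 ∉ t.special → e.2 ∉ t.special →
      Moderate D α c₀ tie (e :: simSeq D α c₀ tie h)) (a b : V)
    (hab : (seqGraph (e :: h)).Adj a b) (ha : a ∉ t.special) (hb : b ∉ t.special) :
    (seqGraph (simSeq D α c₀ tie (e :: h))).Adj a b := by
  rcases seqGraph_cons_adj.1 hab with h1 | ⟨hne, h1⟩
  · have h2 := hs.adj a b h1 (fun h => ha (hst h)) (fun h => hb (hst h))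
    by_cases hm : Moderate D α c₀ tie (e :: simSeq D α c₀ tie h)
    · rw [simSeq_cons_of_moderate hm]
      exact seqGraph_le_cons _ _ h2
    · rwa [simSeq_cons_of_not_moderate hm]
  · rw [simSeq_cons_of_moderate]
    · exact seqGraph_cons_adj.2 (Or.inr ⟨hne, h1⟩)
    · rcases Sym2.eq_iff.1 h1 with ⟨rfl, rfl⟩ | ⟨rfl, rfl⟩
      · exact hmod ha hb
      · exact hmod hb ha

/-- Validity only has to be checked for pairs of special vertices. -/
theorem valid_of_special {h : List (V × V)} {t : StateB V Δ} {c : V → Bool}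
    (hc : IsValid (seqGraph (simSeq D α c₀ tie h)) c)
    (hn : ∀ w ∉ t.special, t.color w = Sum.inl (c w))
    (hm : ∀ w ∈ t.special, ∃ k, t.color w = Sum.inr k)
    (hadj : ∀ a b, (seqGraph h).Adj a b → a ∉ t.special → b ∉ t.special →
      (seqGraph (simSeq D α c₀ tie h)).Adj a b)
    (hsp : ∀ a b, (seqGraph h).Adj a b → a ∈ t.special → b ∈ t.special → t.color a ≠ t.color b) :
    IsValid (seqGraph h) t.color := by
  intro a b hab
  by_cases ha : a ∈ t.special <;> by_cases hb : b ∈ t.special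
  · exact hsp a b hab ha hb
  · obtain ⟨k, hk⟩ := hm a ha
    simp [hk, hn b hb]
  · obtain ⟨k, hk⟩ := hm b hb
    simp [hk, hn a ha]
  · rw [hn a ha, hn b hb]
    exact fun heq => hc (hadj a b hab ha hb) (Sum.inl_injective heq)

theorem isConsistent_of_keepStep {e : V × V} {h : List (V × V)} {s t : StateB V Δ}
    (hA : IsValid (seqGraph (simSeq D α c₀ tie (e :: h)))
      (colA c₀ tie (simSeq D α c₀ tie (e :: h))))
    (hs : IsConsistent D α c₀ tie h s) (hst : KeepStep D α c₀ tie e h s t) :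
    IsConsistent D α c₀ tie (e :: h) t := by
  have hn : ∀ w ∉ t.special,
      t.color w = Sum.inl (colA c₀ tie (simSeq D α c₀ tie (e :: h)) w) := fun w hw =>
    hst.color_of_notMem w (hst.special ▸ hw)
  have hm : ∀ w ∈ t.special, ∃ k, t.color w = Sum.inr k := fun w hw => by
    rw [hst.special] at hw
    rw [hst.color_of_mem w hw]
    exact hs.color_of_mem w hw
  have hadj := adj_step (e := e) hs (t := t) (by rw [hst.special])
    (by rw [hst.special]; exact hst.moderate)
  refine ⟨hn, hm, valid_of_special hA hn hm hadj ?_, hadj⟩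
  intro a b hab ha hb
  rw [hst.special] at ha hb
  rw [hst.color_of_mem a ha, hst.color_of_mem b hb]
  rcases seqGraph_cons_adj.1 hab with h1 | ⟨-, h1⟩
  · exact hs.valid h1
  · rcases Sym2.eq_iff.1 h1 with ⟨rfl, rfl⟩ | ⟨rfl, rfl⟩
    · exact hst.ne ha hb
    · exact (hst.ne hb ha).symm

theorem isConsistent_of_recolorStep {e : V × V} {h : List (V × V)} {s t : StateB V Δ}
    (hA : IsValid (seqGraph (simSeq D α c₀ tie (e :: h)))
      (colA c₀ tie (simSeq D α c₀ tie (e :: h))))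
    (hs : IsConsistent D α c₀ tie h s) (hst : RecolorStep D α c₀ tie e h s t) :
    IsConsistent D α c₀ tie (e :: h) t := by
  have hmem : ∀ w, w ∈ t.special ↔ w = e.1 ∨ w ∈ s.special := fun w => by
    rw [hst.special, Finset.mem_insert]
  have hn : ∀ w ∉ t.special,
      t.color w = Sum.inl (colA c₀ tie (simSeq D α c₀ tie (e :: h)) w) := fun w hw => by
    rw [hmem, not_or] at hw
    exact hst.color_of_notMem w hw.2 hw.1
  have hm : ∀ w ∈ t.special, ∃ k, t.color w = Sum.inr k := fun w hw => by
    by_cases hwe : w = e.1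
    · obtain ⟨k, hk, -⟩ := hst.color_left
      exact ⟨k, hwe ▸ hk⟩
    · have hw' := ((hmem w).1 hw).resolve_left hwe
      rw [hst.color_of_mem w hw' hwe]
      exact hs.color_of_mem w hw'
  have hadj := adj_step (e := e) hs (t := t) (fun w hw => (hmem w).2 (Or.inr hw))
    (fun h1 => absurd ((hmem e.1).2 (Or.inl rfl)) h1)
  refine ⟨hn, hm, valid_of_special hA hn hm hadj ?_, hadj⟩
  obtain ⟨k, hk, hfree⟩ := hst.color_left
  intro a b hab ha hb
  by_cases hae : a = e.1
  · subst hae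
    rw [hk]
    exact (hfree b hab).symm
  by_cases hbe : b = e.1
  · subst hbe
    rw [hk]
    exact hfree a hab.symm
  have ha' := ((hmem a).1 ha).resolve_left hae
  have hb' := ((hmem b).1 hb).resolve_left hbe
  rw [hst.color_of_mem a ha' hae, hst.color_of_mem b hb' hbe]
  rcases seqGraph_cons_adj.1 hab with h1 | ⟨-, h1⟩
  · exact hs.valid h1
  · rcases Sym2.eq_iff.1 h1 with ⟨rfl, rfl⟩ | ⟨rfl, rfl⟩
    · exact absurd rfl hae
    · exact absurd rfl hbe

theorem isConsistent_runB (hpick : ChoosesFree pick) {col : V → Bool} :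
    ∀ {h : List (V × V)}, (∀ e ∈ h, e.1 ≠ e.2) → IsValid (seqGraph h) col →
      (∀ v, ((seqGraph h).neighborSet v).ncard ≤ Δ) →
      IsConsistent D α c₀ tie h (runB D α c₀ tie pick h)
  | [], _, _, _ => by
    refine ⟨fun _ _ => rfl, fun w hw => absurd hw (Finset.notMem_empty w), ?_, ?_⟩ <;>
    · intro a b hab
      simp [seqGraph_nil] at hab
  | e :: h, hl, hcol, hΔ => by
    have hle := seqGraph_le_cons e h
    have hs := isConsistent_runB hpick
      (fun e' he' => hl e' (List.mem_cons_of_mem _ he')) (hcol.mono hle)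
      (fun v => (ncard_neighborSet_mono hle v).trans (hΔ v))
    have hA := (colA_spec c₀ tie
      (fun e' he' => hl e' (mem_of_mem_simSeq D α c₀ tie (e :: h) e' he'))
      (hcol.mono (seqGraph_simSeq_le D α c₀ tie (e :: h)))).1
    rcases runB_cons hpick hΔ hs with hst | hst
    · exact isConsistent_of_keepStep hA hs hst
    · exact isConsistent_of_recolorStep hA hs hst

end Recoloring

namespace Recoloring

open scoped Classical

variable {V : Type*} [Fintype V]

variable {D α : ℝ} {Δ : ℕ} {c₀ : V → Bool} {tie : List (V × V) → Bool}
  {pick : List (V × V) → Finset (Fin (Δ + 1)) → Fin (Δ + 1)}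

/-! ### The cost of algorithm B -/

/-- The edges between special vertices. -/
noncomputable def specialEdges (h : List (V × V)) (S : Finset V) : Finset (Sym2 V) :=
  Finset.univ.filter fun x => x ∈ (seqGraph h).edgeSet ∧ ∀ a ∈ x, a ∈ S

theorem mem_specialEdges {h : List (V × V)} {S : Finset V} {x : Sym2 V} :
    x ∈ specialEdges h S ↔ x ∈ (seqGraph h).edgeSet ∧ ∀ a ∈ x, a ∈ S := by
  simp [specialEdges]

theorem specialEdges_mono (e : V × V) (h : List (V × V)) {S T : Finset V} (hST : S ⊆ T) :
    specialEdges h S ⊆ specialEdges (e :: h) T := by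
  intro x hx
  rw [mem_specialEdges] at hx ⊢
  exact ⟨SimpleGraph.edgeSet_mono (seqGraph_le_cons e h) hx.1, fun a ha => hST (hx.2 a ha)⟩

theorem card_specialEdges_le {h : List (V × V)} {β : ℕ} (hβ : largestBond (seqGraph h) ≤ β)
    (S : Finset V) : (specialEdges h S).card ≤ β * S.card := by
  rcases S.eq_empty_or_nonempty with rfl | hS
  · have : specialEdges h (∅ : Finset V) = ∅ := by
      refine Finset.eq_empty_of_forall_notMem fun x hx => ?_
      have h1 := (mem_specialEdges.1 hx).2
      induction x with | _ a b
      simpa using h1 a (by simp)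
    simp [this]
  -- The components of the empty graph are single vertices, so every edge between special vertices
  -- joins distinct components.
  · have h1 := card_add_le_of_between (H := ⊥) bot_le hβ _
      (S.image (SimpleGraph.connectedComponentMk ⊥)) (specialEdges h S) rfl (hS.image _) (by
        intro x hx
        obtain ⟨hx, hxS⟩ := mem_specialEdges.1 hx
        induction x with | _ a b
        refine ⟨a, b, rfl, hx, Finset.mem_image_of_mem _ (hxS a (by simp)),
          Finset.mem_image_of_mem _ (hxS b (by simp)), ?_⟩
        rw [Ne, SimpleGraph.ConnectedComponent.eq, SimpleGraph.reachable_bot]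
        exact ((seqGraph h).mem_edgeSet.1 hx).ne)
    exact (Nat.le_add_right _ _).trans (h1.trans (Nat.mul_le_mul_left _ Finset.card_image_le))

theorem sum_colorCost_le {price : Fin (Δ + 1) → ℝ} {c c' : V → Color Δ} {T : Finset V}
    (hT : ∀ w, c w ≠ c' w → w ∈ T ∧ ∃ b, c' w = Sum.inl b) :
    ∑ w ∈ changed c c', colorCost price (c' w) ≤ T.card := by
  have h1 : ∑ w ∈ changed c c', colorCost price (c' w) = ∑ w ∈ changed c c', 1 := by
    refine Finset.sum_congr rfl fun w hw => ?_
    obtain ⟨-, b, hb⟩ := hT w (mem_changed.1 hw)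
    rw [hb]
    rfl
  rw [h1, Finset.sum_const, nsmul_eq_mul, mul_one]
  exact_mod_cast Finset.card_le_card fun w hw => (hT w (mem_changed.1 hw)).1

/-- `u` is the one vertex that may receive a special color; its cost `D` is split off. -/
theorem sum_colorCost_le_add {price : Fin (Δ + 1) → ℝ} (hD : 1 ≤ D) (hprice : ∀ k, price k ≤ D)
    {c c' : V → Color Δ} {T : Finset V} (u : V)
    (hT : ∀ w, w ≠ u → c w ≠ c' w → w ∈ T ∧ ∃ b, c' w = Sum.inl b) :
    ∑ w ∈ changed c c', colorCost price (c' w) ≤ T.card + D := by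
  have hu : colorCost price (c' u) ≤ D := by
    rcases c' u with b | k
    · exact hD
    · exact hprice k
  have h1 : ∑ w ∈ (changed c c').erase u, colorCost price (c' w) ≤ T.card := by
    have h2 : ∑ w ∈ (changed c c').erase u, colorCost price (c' w) =
        ∑ w ∈ (changed c c').erase u, 1 := by
      refine Finset.sum_congr rfl fun w hw => ?_
      obtain ⟨hne, hw⟩ := Finset.mem_erase.1 hw
      obtain ⟨-, b, hb⟩ := hT w hne (mem_changed.1 hw)
      rw [hb]
      rfl
    rw [h2, Finset.sum_const, nsmul_eq_mul, mul_one]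
    refine Nat.cast_le.2 (Finset.card_le_card fun w hw => ?_)
    obtain ⟨hne, hw⟩ := Finset.mem_erase.1 hw
    exact (hT w hne (mem_changed.1 hw)).1
  by_cases hmem : u ∈ changed c c'
  · rw [← Finset.sum_erase_add _ _ hmem]
    linarith
  · rw [Finset.erase_eq_of_notMem hmem] at h1
    linarith

theorem costA_simSeq_cons (e : V × V) (h : List (V × V)) :
    costA c₀ tie Finset.univ (simSeq D α c₀ tie (e :: h)) =
      costA c₀ tie Finset.univ (simSeq D α c₀ tie h) +
        (changed (colA c₀ tie (simSeq D α c₀ tie h))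
          (colA c₀ tie (simSeq D α c₀ tie (e :: h)))).card := by
  by_cases hm : Moderate D α c₀ tie (e :: simSeq D α c₀ tie h)
  · rw [simSeq_cons_of_moderate hm, costA, Finset.univ_inter]
  · rw [simSeq_cons_of_not_moderate hm, changed_self, Finset.card_empty, add_zero]

/-- This counts the special recolorings. Either `e.1` is newly special, or two special ends had
equal colors; then the edge is new, since the old coloring was valid for the old edges. -/
theorem card_add_card_specialEdges_lt {e : V × V} {h : List (V × V)} {s t : StateB V Δ}
    (he : e.1 ≠ e.2) (hs : IsConsistent D α c₀ tie h s)
    (hst : RecolorStep D α c₀ tie e h s t) :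
    s.special.card + (specialEdges h s.special).card + 1 ≤
      t.special.card + (specialEdges (e :: h) t.special).card := by
  have hsub : s.special ⊆ t.special := by
    rw [hst.special]
    exact Finset.subset_insert _ _
  have hle := Finset.card_le_card hsub
  have hle' := Finset.card_le_card (specialEdges_mono e h hsub)
  rcases hst.reason with ⟨h1, h2, h3⟩ | ⟨h1, -⟩
  · have hlt : (specialEdges h s.special).card < (specialEdges (e :: h) t.special).card := by
      refine Finset.card_lt_card (Finset.ssubset_iff_subset_ne.2
        ⟨specialEdges_mono e h hsub, fun heq => ?_⟩)
      have hmem : s(e.1, e.2) ∈ specialEdges (e :: h) t.special :=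
        mem_specialEdges.2 ⟨seqGraph_cons_adj.2 (Or.inr ⟨he, rfl⟩), by
          simpa using ⟨hsub h1, hsub h2⟩⟩
      rw [← heq, mem_specialEdges] at hmem
      exact hs.valid hmem.1 h3
    omega
  · rw [hst.special, Finset.card_insert_of_notMem h1] at hle ⊢
    rw [hst.special] at hle'
    omega

/-- A new special vertex is charged to the edge being rejected. That edge cannot have been rejected
before: with neither end special, the invariant would place it in the simulated graph, whereas a
rejected edge joins different simulated components. -/
theorem card_special_le_card_rejected (hα : 0 < α) (hpick : ChoosesFree pick) {col : V → Bool} :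
    ∀ {h : List (V × V)}, (∀ e ∈ h, e.1 ≠ e.2) → IsValid (seqGraph h) col →
      (∀ v, ((seqGraph h).neighborSet v).ncard ≤ Δ) →
      (runB D α c₀ tie pick h).special.card ≤ (rejected D α c₀ tie h).card
  | [], _, _, _ => le_rfl
  | e :: h, hl, hcol, hΔ => by
    have hle := seqGraph_le_cons e h
    have hl' : ∀ e ∈ h, e.1 ≠ e.2 := fun e' he' => hl e' (List.mem_cons_of_mem _ he')
    have hΔ' := fun v => (ncard_neighborSet_mono hle v).trans (hΔ v)
    have ih := card_special_le_card_rejected hα hpick hl'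
      (hcol.mono hle) hΔ'
    have hs := isConsistent_runB (D := D) (α := α) (c₀ := c₀) (tie := tie) hpick hl'
      (hcol.mono hle) hΔ'
    have hrej : (rejected D α c₀ tie h).card ≤ (rejected D α c₀ tie (e :: h)).card := by
      refine Finset.card_le_card ?_
      rw [rejected]
      split_ifs
      · exact subset_rfl
      · exact Finset.subset_insert _ _
    rcases runB_cons hpick hΔ hs with hst | hst
    · rw [hst.special]
      exact ih.trans hrej
    · rw [hst.special]
      rcases hst.reason with ⟨h1, -⟩ | ⟨h1, h2, hm⟩
      · rw [Finset.insert_eq_self.2 h1]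
        exact ih.trans hrej
      · rw [Finset.card_insert_of_notMem h1, rejected, if_neg hm, Finset.card_insert_of_notMem]
        · omega
        · intro hmem
          exact (not_moderate hα hm).1
            (hs.adj _ _ (rejected_spec hα hl' _ hmem).1 h1 h2).reachable

/-- Vertices that are not special follow the simulation, so their recolorings are counted by
`costA`; each special recoloring costs at most `D` and is paid by the increase of the second
summand. -/
theorem costB_le_costA_add {price : Fin (Δ + 1) → ℝ} (hD : 1 ≤ D) (hprice : ∀ k, price k ≤ D)
    (hpick : ChoosesFree pick) {col : V → Bool} :
    ∀ {h : List (V × V)}, (∀ e ∈ h, e.1 ≠ e.2) → IsValid (seqGraph h) col →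
      (∀ v, ((seqGraph h).neighborSet v).ncard ≤ Δ) →
      costB D α c₀ tie pick price h ≤ costA c₀ tie Finset.univ (simSeq D α c₀ tie h) +
        D * ((runB D α c₀ tie pick h).special.card +
          (specialEdges h (runB D α c₀ tie pick h).special).card : ℕ)
  | [], _, _, _ => by
    rw [costB]
    positivity
  | e :: h, hl, hcol, hΔ => by
    have hle := seqGraph_le_cons e h
    have hl' : ∀ e ∈ h, e.1 ≠ e.2 := fun e' he' => hl e' (List.mem_cons_of_mem _ he')
    have hΔ' := fun v => (ncard_neighborSet_mono hle v).trans (hΔ v)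
    have ih := costB_le_costA_add hD hprice hpick hl'
      (hcol.mono hle) hΔ'
    have hs := isConsistent_runB (D := D) (α := α) (c₀ := c₀) (tie := tie) hpick hl'
      (hcol.mono hle) hΔ'
    rw [costB, costA_simSeq_cons]
    push_cast only [Nat.cast_add (costA _ _ _ _)]
    rcases runB_cons hpick hΔ hs with hst | hst
    · have h1 := sum_colorCost_le (price := price) (T := changed (colA c₀ tie (simSeq D α c₀ tie h))
        (colA c₀ tie (simSeq D α c₀ tie (e :: h)))) (c := (runB D α c₀ tie pick h).color)
        (c' := (runB D α c₀ tie pick (e :: h)).color) (by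
          intro w hw
          have hwn : w ∉ (runB D α c₀ tie pick h).special := fun hmem =>
            hw (hst.color_of_mem w hmem).symm
          rw [hst.color_of_notMem w hwn, hs.color_of_notMem w hwn] at hw
          exact ⟨mem_changed.2 fun heq => hw (congrArg _ heq), _, hst.color_of_notMem w hwn⟩)
      have h2 : (((runB D α c₀ tie pick h).special.card +
          (specialEdges h (runB D α c₀ tie pick h).special).card : ℕ) : ℝ) ≤
          ((runB D α c₀ tie pick (e :: h)).special.card +
          (specialEdges (e :: h) (runB D α c₀ tie pick (e :: h)).special).card : ℕ) := by
        rw [hst.special]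
        exact_mod_cast Nat.add_le_add_left
          (Finset.card_le_card (specialEdges_mono e h subset_rfl)) _
      have h3 := mul_le_mul_of_nonneg_left h2 (by linarith : 0 ≤ D)
      linarith
    · have h1 := sum_colorCost_le_add (price := price) hD hprice
        (T := changed (colA c₀ tie (simSeq D α c₀ tie h))
        (colA c₀ tie (simSeq D α c₀ tie (e :: h)))) (c := (runB D α c₀ tie pick h).color)
        (c' := (runB D α c₀ tie pick (e :: h)).color) e.1 (by
          intro w hne hw
          have hwn : w ∉ (runB D α c₀ tie pick h).special := fun hmem =>
            hw (hst.color_of_mem w hmem hne).symm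
          rw [hst.color_of_notMem w hwn hne, hs.color_of_notMem w hwn] at hw
          exact ⟨mem_changed.2 fun heq => hw (congrArg _ heq), _,
            hst.color_of_notMem w hwn hne⟩)
      have h2 : (((runB D α c₀ tie pick h).special.card +
          (specialEdges h (runB D α c₀ tie pick h).special).card : ℕ) : ℝ) + 1 ≤
          ((runB D α c₀ tie pick (e :: h)).special.card +
          (specialEdges (e :: h) (runB D α c₀ tie pick (e :: h)).special).card : ℕ) := by
        exact_mod_cast card_add_card_specialEdges_lt (hl e (by simp)) hs hst
      have h3 := mul_le_mul_of_nonneg_left h2 (by linarith : 0 ≤ D)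
      linarith

/-- Excludes `β = 0` once an edge has arrived, so that constants can be absorbed into `β ^ 2`. -/
theorem one_le_largestBond {h : List (V × V)} {e : V × V} (heh : e ∈ h) (he : e.1 ≠ e.2) :
    1 ≤ largestBond (seqGraph h) := by
  have hadj : (seqGraph h).Adj e.1 e.2 := by
    rw [seqGraph, SimpleGraph.fromRel_adj]
    exact ⟨he, Or.inl heh⟩
  obtain ⟨S, hS, -, hcard⟩ := exists_small_cut (G := seqGraph h) (H := ⊥) (u := e.1) (v := e.2)
    bot_le (by rwa [SimpleGraph.reachable_bot])
  refine le_trans (Nat.succ_le_of_lt ?_) hcard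
  exact (Set.ncard_pos (Set.toFinite _)).2 ⟨_, mk_mem_edgeCut.2 ⟨hadj, hS⟩⟩

/-- The factor of the competitive ratio that depends on `α`. -/
noncomputable def ratioConstant (α : ℝ) : ℝ :=
  7 * (Real.log 5 / Real.log (5 / 4) + 10 / (1 - α)) + 7 / Real.log (5 / 4) + 2 / α

theorem ratioConstant_pos (hα₀ : 0 < α) (hα : α < 1) : 0 < ratioConstant α := by
  have h1 := log_five_fourths_pos
  have h2 : 0 < Real.log 5 := Real.log_pos (by norm_num)
  have h3 : 0 < 1 - α := by linarith
  rw [ratioConstant]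
  positivity

theorem costB_le {price : Fin (Δ + 1) → ℝ} (hα₀ : 0 < α) (hα : α < 1) (hD : 1 ≤ D)
    (hprice : ∀ k, price k ≤ D) (hpick : ChoosesFree pick) {col : V → Bool} {σ : List (V × V)}
    (hl : ∀ e ∈ σ, e.1 ≠ e.2) (hcol : IsValid (seqGraph σ) col)
    (hΔ : ∀ v, ((seqGraph σ).neighborSet v).ncard ≤ Δ) {β : ℕ}
    (hβ : largestBond (seqGraph σ) ≤ β) :
    costB D α c₀ tie pick price σ ≤ ratioConstant α * (recoloredSim D α c₀ tie σ).card *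
      ((β : ℝ) ^ 2 + Real.log D) := by
  -- The empty sequence is separate because `β` may then be `0`; both sides vanish.
  rcases σ with _ | ⟨e, h⟩
  · simp [costB, recoloredSim, simSeq, recoloredA]
  have hβ1 : (1 : ℝ) ≤ β := by
    exact_mod_cast (one_le_largestBond (by simp) (hl e (by simp))).trans hβ
  generalize e :: h = σ at *
  set r : ℝ := ((recoloredSim D α c₀ tie σ).card : ℝ)
  have hr0 : 0 ≤ r := Nat.cast_nonneg _
  have hA := costA_le hα₀ hα hD c₀ tie
    (fun e' he' => hl e' (mem_of_mem_simSeq D α c₀ tie σ e' he'))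
    (hcol.mono (seqGraph_simSeq_le D α c₀ tie σ)) (moderate_simSeq D α c₀ tie σ)
  change _ ≤ r * _ at hA
  have hB := costB_le_costA_add (α := α) (c₀ := c₀) (tie := tie) hD hprice hpick hl hcol hΔ
  have hsp := card_special_le_card_rejected (D := D) (c₀ := c₀) (tie := tie) hα₀ hpick hl hcol hΔ
  have hed := card_specialEdges_le hβ (runB D α c₀ tie pick σ).special
  have hrej := card_rejected_le (c₀ := c₀) (tie := tie) hα₀ hD hβ hl
  set S := (runB D α c₀ tie pick σ).special
  have hsp' : (S.card : ℝ) ≤ (rejected D α c₀ tie σ).card := by exact_mod_cast hsp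
  have hed' : ((specialEdges σ S).card : ℝ) ≤ β * S.card := by exact_mod_cast hed
  have hDS : D * S.card ≤ β * r / α := by
    rw [le_div_iff₀ hα₀]
    have := mul_le_mul_of_nonneg_left hsp' (mul_pos hα₀ (by linarith : 0 < D)).le
    linarith
  -- One factor `β` comes from the edges among special vertices (`|S| + β|S| ≤ 2β|S|`), the other
  -- from the number of rejected edges bounding `|S|`; the price `D` cancels.
  have hspecial : D * ((S.card + (specialEdges σ S).card : ℕ) : ℝ) ≤
      2 / α * r * (β : ℝ) ^ 2 := by
    have h1 : ((S.card + (specialEdges σ S).card : ℕ) : ℝ) ≤ (2 * β) * S.card := by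
      push_cast
      have := mul_le_mul_of_nonneg_right hβ1 (Nat.cast_nonneg (α := ℝ) S.card)
      linarith
    calc D * ((S.card + (specialEdges σ S).card : ℕ) : ℝ) ≤ D * ((2 * β) * S.card) :=
          mul_le_mul_of_nonneg_left h1 (by linarith)
      _ = (2 * β) * (D * S.card) := by ring
      _ ≤ (2 * β) * (β * r / α) := mul_le_mul_of_nonneg_left hDS (by positivity)
      _ = 2 / α * r * (β : ℝ) ^ 2 := by ring
  have hlog : 0 ≤ Real.log D := Real.log_nonneg hD
  have hβ2 : (1 : ℝ) ≤ (β : ℝ) ^ 2 := one_le_pow₀ hβ1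
  have h54 := log_five_fourths_pos
  have h5 : 0 ≤ Real.log 5 := Real.log_nonneg (by norm_num)
  have h1α : 0 < 1 - α := by linarith
  refine hB.trans ((add_le_add hA hspecial).trans ?_)
  set K : ℝ := Real.log 5 / Real.log (5 / 4) + 10 / (1 - α) with hK
  have hK0 : 0 ≤ K := by positivity
  have e1 : r * (7 * ((Real.log 5 + Real.log D) / Real.log (5 / 4) + 10 / (1 - α))) =
      r * (7 * K) + r * (7 / Real.log (5 / 4)) * Real.log D := by
    rw [hK]; ring
  have e2 : ratioConstant α = 7 * K + 7 / Real.log (5 / 4) + 2 / α := rfl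
  have f1 : r * (7 * K) ≤ r * (7 * K) * ((β : ℝ) ^ 2 + Real.log D) :=
    le_mul_of_one_le_right (by positivity) (by linarith)
  have f2 : 0 ≤ r * (7 / Real.log (5 / 4)) * (β : ℝ) ^ 2 := by positivity
  have f3 : 0 ≤ 2 / α * r * Real.log D := by positivity
  rw [e1, e2]
  linarith

end Recoloring

/-! ### The competitive bounds -/

theorem mainTheorem1 (α : ℝ) (hα₀ : 0 < α) (hα₁ : α < 1) :
    ∃ C : ℝ, 0 < C ∧ ∃ C' : ℕ → ℝ, (∀ β, 0 < C' β) ∧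
      ∀ (V : Type*) [Fintype V] (σ : List (V × V)) (c₀ : V → Bool) (Δ β : ℕ) (D : ℝ)
        (price : Fin (Δ + 1) → ℝ) (tie : List (V × V) → Bool)
        (pick : List (V × V) → Finset (Fin (Δ + 1)) → Fin (Δ + 1)),
        (∀ e ∈ σ, e.1 ≠ e.2) →
        (Recoloring.seqGraph σ).IsBipartite →
        (∀ v, ((Recoloring.seqGraph σ).neighborSet v).ncard ≤ Δ) →
        Recoloring.largestBond (Recoloring.seqGraph σ) ≤ β →
        1 ≤ D →
        (∀ k, 0 ≤ price k ∧ price k ≤ D) →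
        Recoloring.ChoosesFree pick →
        (∀ h, h <:+ σ → Recoloring.IsValid (Recoloring.seqGraph h)
            (Recoloring.runB D α c₀ tie pick h).color) ∧
        Recoloring.costB D α c₀ tie pick price σ
            ≤ C * (Recoloring.recoloredSim D α c₀ tie σ).card * ((β : ℝ) ^ 2 + Real.log D) ∧
        (Recoloring.recoloredSim D α c₀ tie σ).card ≤ 3 * Recoloring.opt c₀ σ ∧
        Recoloring.costB D α c₀ tie pick price σ
            ≤ C * ((β : ℝ) ^ 2 + Real.log D) * Recoloring.opt c₀ σ ∧
        (2 ≤ D → Recoloring.costB D α c₀ tie pick price σ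
            ≤ C' β * Real.log D * Recoloring.opt c₀ σ) := by
  -- The factor `3` is that of `|R| ≤ 3 OPT`. For `D ≥ 2`, `log D ≥ log 2` lets `β ^ 2` be absorbed
  -- as `β ^ 2 / log 2 * log D`.
  refine ⟨3 * Recoloring.ratioConstant α, ?_,
    fun β => 3 * Recoloring.ratioConstant α * ((β : ℝ) ^ 2 / Real.log 2 + 1), ?_, ?_⟩
  · have := Recoloring.ratioConstant_pos hα₀ hα₁
    positivity
  · intro β
    have := Recoloring.ratioConstant_pos hα₀ hα₁
    have := Real.log_pos one_lt_two
    positivity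
  intro V _ σ c₀ Δ β D price tie pick hl hbip hΔ hβ hD hprice hpick
  have hratio := Recoloring.ratioConstant_pos hα₀ hα₁
  obtain ⟨col, hcol⟩ : ∃ col : V → Bool, Recoloring.IsValid (Recoloring.seqGraph σ) col := by
    obtain ⟨f⟩ := hbip
    exact ⟨fun v => finTwoEquiv (f v), fun a b hab heq =>
      f.valid hab (finTwoEquiv.injective heq)⟩
  have hcost := Recoloring.costB_le (c₀ := c₀) (tie := tie) hα₀ hα₁ hD (fun k => (hprice k).2)
    hpick hl hcol hΔ hβ
  have hopt := Recoloring.card_recoloredSim_le_opt D α c₀ tie hl hcol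
  have hopt' : ((Recoloring.recoloredSim D α c₀ tie σ).card : ℝ) ≤
      3 * Recoloring.opt c₀ σ := by exact_mod_cast hopt
  have hlog : 0 ≤ Real.log D := Real.log_nonneg hD
  have hratioOpt : Recoloring.costB D α c₀ tie pick price σ ≤
      3 * Recoloring.ratioConstant α * ((β : ℝ) ^ 2 + Real.log D) * Recoloring.opt c₀ σ :=
    calc _ ≤ _ := hcost
      _ ≤ Recoloring.ratioConstant α * (3 * Recoloring.opt c₀ σ) *
          ((β : ℝ) ^ 2 + Real.log D) := by gcongr
      _ = _ := by ring
  refine ⟨?_, ?_, hopt, hratioOpt, ?_⟩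
  · intro h hh
    have hle : Recoloring.seqGraph h ≤ Recoloring.seqGraph σ :=
      Recoloring.seqGraph_mono fun e he => hh.subset he
    exact (Recoloring.isConsistent_runB hpick (fun e he => hl e (hh.subset he)) (hcol.mono hle)
      fun v => (Recoloring.ncard_neighborSet_mono hle v).trans (hΔ v)).valid
  · refine hcost.trans ?_
    gcongr
    linarith
  · intro hD2
    refine hratioOpt.trans ?_
    have hlog2 : 0 < Real.log 2 := Real.log_pos one_lt_two
    have hlogle : Real.log 2 ≤ Real.log D := Real.log_le_log two_pos hD2
    have hβ2 : (β : ℝ) ^ 2 ≤ (β : ℝ) ^ 2 / Real.log 2 * Real.log D := by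
      rw [div_mul_eq_mul_div, le_div_iff₀ hlog2]
      exact mul_le_mul_of_nonneg_left hlogle (by positivity)
    have hsum : (β : ℝ) ^ 2 + Real.log D ≤ ((β : ℝ) ^ 2 / Real.log 2 + 1) * Real.log D := by
      linarith
    calc _ ≤ 3 * Recoloring.ratioConstant α *
          (((β : ℝ) ^ 2 / Real.log 2 + 1) * Real.log D) * Recoloring.opt c₀ σ := by gcongr
      _ = _ := by ring
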